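/- **Setting.** Let $\Pi$ be a (possibly infinite) set of processes, $(\mathcal O,\sqsubseteq)$ and $(\mathcal C,\sqsubseteq)$ join semi-lattices (objects and configurations) with initial states $O_0,C_0$. A *state* is a pair $u=(u.O,u.C)\in\mathcal L=\mathcal O\times\mathcal C$, ordered componentwise. Every configuration $C$ has a finite set $\mathrm{members}(C)\subseteq\Pi$ and a family $\mathrm{quorums}(C)$ of subsets of $\mathrm{members}(C)$, any two of which (possibly equal) intersect. **Algorithm** (code of process $p$). Variables: $seq_p=0$, $v_p=(O_0,C_0)$, $obj_p=O_0$, $T_p=\emptyset$ (a finite set of configurations). Write $D_p=(obj_p,\bigsqcup(\{v_p.C\}\cup T_p))$. * $\mathrm{updateState}(v,s_O,S_C)$: $v_p:=v_p\sqcup v$; $obj_p:=obj_p\sqcup s_O$; $T_p:=\{u\in T_p\cup S_C : u\not\sqsubseteq v_p.C\}$. * $\mathrm{propose}(x)$: run $\mathrm{updateState}(v_p,x.O,\{x.C\})$; set $learnLB:=\bot$; then repeat: 1. $seq_p:=seq_p+1$; $oldCommit:=v_p$; $(oldObj,oldT):=(obj_p,T_p)$; $V:=\{\bigsqcup(\{v_p.C\}\cup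 A): A\subseteq T_p\}$; send $\langle(REQ,seq_p),(v_p,obj_p,T_p)\rangle$ to $\bigcup_{u\in V}\mathrm{members}(u)$; 2. wait until $oldCommit.C\ne v_p.C$, or for every $u\in V$ responses $\langle(RESP,seq_p),\_\rangle$ have been received from all members of some quorum in $\mathrm{quorums}(u)$; 3. if $oldCommit.C=v_p.C$ and $oldT=T_p$: (a) if $learnLB=\bot$, set $learnLB:=D_p$; (b) if moreover $oldObj=obj_p$, broadcast $\langle COMMIT,(D_p,obj_p,\emptyset)\rangle$ and return $D_p$; 4. if $learnLB\neq\bot$ and $learnLB\sqsubseteq v_p$, return $v_p$. * On receiving any message (request, response or delivered broadcast) with content $m$: run $\mathrm{updateState}(m)$; if it is a request $(REQ,n)$ from $q$, send $\langle(RESP,n),(v_p,obj_p,T_p)\rangle$ to $q$. Code is executed atomically up to a return or the wait. Communication is asynchronous (arbitrary delays and order, losses and duplications allowed, but no message is received that was not sent, or delivered that was not broadcast). Any process may crash at any time (also between its broadcast and its return) and then takes no more steps. A process invokes propose only when its previous operation has returned. It *learns* the value that its propose returns. **Theorem.** Every execution of the algorithm satisfies: 1. **Consistency.** The learnt states are totally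 ordered by $\sqsubseteq$. 2. **Validity.** If $\mathrm{propose}(x)$ returns $y$, then $y$ is the join of $(O_0,C_0)$ and finitely many values proposed before the return, among them $x$ (hence simply a join of proposed values including $x$ when $(O_0,C_0)\sqsubseteq x$), and $y\sqsupseteq z$ for every value $z$ learnt before the invocation. 3. **Reconfigurable Liveness.** If only finitely many distinct configurations are proposed, finitely many processes invoke propose, and assumptions (a)–(e) below hold, then every propose invoked by a correct client (a process that invokes propose and does not fail while executing a propose) eventually returns. *Terminology for 3.* A configuration is *potential* at a given time if it is the join of $C_0$ and a finite (possibly empty) set of already proposed configurations; it is *superseded* once some state with a strictly greater configuration has been learnt. A replica is *active* when it is a member of a potential, not superseded configuration, and *correct* if from some time on it is forever active and not failed. A *correct participant* is a correct replica, or a process that invokes propose at least once and never fails. (a) Fair scheduling: a process that never fails and whose wait condition holds eventually continues. (b) Reliable channels: every message sent by a correct participant to a correct participant is received. (c) Reliable broadcast: a correct participant delivers every message it broadcasts, and a message delivered by some correct participant is delivered by every correct participant. (d) Every correct participant $q$ is eventually informed of every learnt configuration $C$, i.e. $C\sqsubseteq v_q.C$ at some time. (e) Configuration availability: every potential configuration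 that is never superseded has a quorum consisting of correct replicas. -/

import Mathlib

namespace RLA

/-! ## The reconfigurable lattice and its quorum systems -/

/-- The data of a reconfigurable lattice `O × C` (with the componentwise order): an object
lattice `O` and a configuration lattice `C`, their initial states, and for every configuration
its members and a quorum system on them. Any two quorums of the same configuration intersect
(in particular a quorum is not empty). -/
structure System (P O C : Type*) [SemilatticeSup O] [SemilatticeSup C] where
  O₀ : O
  C₀ : C
  members : C → Finset P
  quorums : C → Set (Finset P)
  quorum_subset : ∀ c, ∀ Q ∈ quorums c, Q ⊆ members c
  quorum_inter : ∀ c, ∀ Q ∈ quorums c, ∀ Q' ∈ quorums c, ∃ r, r ∈ Q ∧ r ∈ Q'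

/-- The initial state `(O₀, C₀)`. -/
def System.start {P O C : Type*} [SemilatticeSup O] [SemilatticeSup C]
    (S : System P O C) : O × C := (S.O₀, S.C₀)

open Classical in
/-- The join of the finite set `{c} ∪ A`. -/
noncomputable def joinWith {C : Type*} [SemilatticeSup C] (c : C) (A : Finset C) : C :=
  (insert c A).sup' (Finset.insert_nonempty c A) id

/-! ## Local states and messages -/

/-- The tracked variables `(v_p, obj_p, T_p)` of a process; also the content of a message. -/
structure Tracked (O C : Type*) where
  v : O × C
  obj : O
  T : Finset C

/-- The candidate decision `(obj_p, ⨆ ({v_p.C} ∪ T_p))`. -/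
noncomputable def Tracked.candidate {O C : Type*} [SemilatticeSup C] (a : Tracked O C) : O × C :=
  (a.obj, joinWith a.v.2 a.T)

/-- The queried configurations `V = {⨆ ({v_p.C} ∪ A) | A ⊆ T_p}`. -/
def Tracked.queried {O C : Type*} [SemilatticeSup C] (a : Tracked O C) : Set C :=
  {u | ∃ A : Finset C, A ⊆ a.T ∧ u = joinWith a.v.2 A}

open Classical in
/-- Procedure `updateState`, applied to the tracked variables `a` with argument `b`. -/
noncomputable def updateState {O C : Type*} [SemilatticeSup O] [SemilatticeSup C]
    (a b : Tracked O C) : Tracked O C where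
  v := a.v ⊔ b.v
  obj := a.obj ⊔ b.obj
  T := (a.T ∪ b.T).filter (fun u => ¬ u ≤ (a.v ⊔ b.v).2)

/-- Type of a point-to-point message, with its sequence number. -/
inductive Kind where
  | req (n : ℕ)
  | resp (n : ℕ)

/-- A point-to-point message. -/
structure Packet (P O C : Type*) where
  src : P
  dst : P
  kind : Kind
  content : Tracked O C

/-- A broadcast `COMMIT` message: the process that broadcast it and the committed state. -/
structure CommitMsg (P O C : Type*) where
  origin : P
  state : O × C

/-- Content `(s, s.O, ∅)` of the `COMMIT` message for the state `s`. -/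
def CommitMsg.content {P O C : Type*} (m : CommitMsg P O C) : Tracked O C where
  v := m.state
  obj := m.state.1
  T := ∅

/-- The variables of a pending `propose` operation, which is waiting for the end of its current
round of requests. `responders` is the set of processes from which a response with the current
sequence number has been received. -/
structure Pending (P O C : Type*) where
  learnLB : Option (O × C)
  oldCommit : O × C
  oldObj : O
  oldT : Finset C
  V : Set C
  responders : Set P

/-- Local state of a process; `op = none` if no `propose` is being executed. -/
structure Local (P O C : Type*) where
  seq : ℕ
  vars : Tracked O C
  op : Option (Pending P O C)
  crashed : Bool

/-- Beginning of an iteration of the while loop, up to the wait. -/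
def Local.startRound {P O C : Type*} [SemilatticeSup C] (l : Local P O C)
    (lb : Option (O × C)) : Local P O C :=
  { l with
    seq := l.seq + 1
    op := some
      { learnLB := lb
        oldCommit := l.vars.v
        oldObj := l.vars.obj
        oldT := l.vars.T
        V := l.vars.queried
        responders := ∅ } }

/-- The requests that `p` sends when it has just entered, in local state `l`, a new round: one
to each member of each queried configuration. -/
def requests {P O C : Type*} [SemilatticeSup O] [SemilatticeSup C] (S : System P O C) (p : P)
    (l : Local P O C) : Set (Packet P O C) :=
  {m | m.src = p ∧ m.kind = Kind.req l.seq ∧ m.content = l.vars ∧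
    ∃ u ∈ l.vars.queried, m.dst ∈ S.members u}

/-- The condition of the `wait until`. -/
def waitOver {P O C : Type*} [SemilatticeSup O] [SemilatticeSup C] (S : System P O C)
    (l : Local P O C) (k : Pending P O C) : Prop :=
  k.oldCommit.2 ≠ l.vars.v.2 ∨
    ∀ u ∈ k.V, ∃ Q ∈ S.quorums u, ∀ r ∈ Q, r ∈ k.responders

/-- `oldCommit.C = v_p.C ∧ oldCandidates = (_, T_p)`. -/
def stableConfs {P O C : Type*} (l : Local P O C) (k : Pending P O C) : Prop :=
  k.oldCommit.2 = l.vars.v.2 ∧ k.oldT = l.vars.T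

/-- Both tests that precede the commit succeed: stable configurations and unchanged object. -/
def canCommit {P O C : Type*} (l : Local P O C) (k : Pending P O C) : Prop :=
  stableConfs l k ∧ k.oldObj = l.vars.obj

open Classical in
/-- Value of `learnLB` at the end of the iteration. -/
noncomputable def newLearnLB {P O C : Type*} [SemilatticeSup C] (l : Local P O C)
    (k : Pending P O C) : Option (O × C) :=
  if stableConfs l k ∧ k.learnLB = none then some l.vars.candidate else k.learnLB

/-- `learnLB ≠ ⊥ ∧ learnLB ⊑ v_p` at the end of the iteration. -/
def canAdopt {P O C : Type*} [SemilatticeSup O] [SemilatticeSup C] (l : Local P O C)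
    (k : Pending P O C) : Prop :=
  ∃ b, newLearnLB l k = some b ∧ b ≤ l.vars.v

open Classical in
/-- Reception by the process with local state `l` of a message of kind `kind` from `q`: merge
the content, and record a response to the current round of requests. -/
noncomputable def Local.receive {P O C : Type*} [SemilatticeSup O] [SemilatticeSup C]
    (l : Local P O C) (q : P) (kind : Kind) (content : Tracked O C) : Local P O C :=
  { l with
    vars := updateState l.vars content
    op := l.op.map fun k =>
      if kind = Kind.resp l.seq then { k with responders := insert q k.responders } else k }

/-- The response (if any) to the packet `m`, given the local state `l` of its receiver
after it has merged the content of `m`. -/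
def responses {P O C : Type*} (m : Packet P O C) (l : Local P O C) : Set (Packet P O C) :=
  {a | ∃ n, m.kind = Kind.req n ∧ a = ⟨m.dst, m.src, Kind.resp n, l.vars⟩}

/-! ## Executions -/

/-- Global state: local states, packets sent so far, `COMMIT` messages broadcast so far. -/
structure Global (P O C : Type*) where
  loc : P → Local P O C
  net : Set (Packet P O C)
  bcasts : Set (CommitMsg P O C)

/-- Initial global state. -/
def Global.initial {P O C : Type*} [SemilatticeSup O] [SemilatticeSup C] (S : System P O C) :
    Global P O C where
  loc := fun _ =>
    { seq := 0
      vars := { v := S.start, obj := S.O₀, T := ∅ }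
      op := none
      crashed := false }
  net := ∅
  bcasts := ∅

open Classical in
/-- Replace the local state of `p`. -/
noncomputable def Global.setLoc {P O C : Type*} (g : Global P O C) (p : P) (l : Local P O C) :
    Global P O C :=
  { g with loc := Function.update g.loc p l }

/-- The events of an execution. `commit` and `adopt` are the two ways to return a state;
`commitCrash` is a process that broadcasts its state but fails before it returns. -/
inductive Event (P O C : Type*) where
  | silent
  | invoke (p : P) (prop : O × C)
  | nextRound (p : P)
  | commit (p : P) (s : O × C)
  | commitCrash (p : P) (s : O × C)
  | adopt (p : P) (s : O × C)
  | receive (m : Packet P O C)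
  | deliver (q : P) (m : CommitMsg P O C)
  | crash (p : P)

/-- The steps of the algorithm. A process runs its code atomically until it returns or reaches
the wait; sent messages are received in any order, after any delay, possibly several times or
never; any process may crash at any time, and then takes no further step. -/
inductive Step {P O C : Type*} [SemilatticeSup O] [SemilatticeSup C] (S : System P O C) :
    Global P O C → Event P O C → Global P O C → Prop
  | silent (g : Global P O C) : Step S g Event.silent g
  | invoke (g : Global P O C) (p : P) (prop : O × C) (l : Local P O C)
      (alive : (g.loc p).crashed = false) (idle : (g.loc p).op = none)
      (hl : l = ({ g.loc p with
        vars := updateState (g.loc p).vars ⟨(g.loc p).vars.v, prop.1, {prop.2}⟩ } :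
          Local P O C).startRound none) :
      Step S g (Event.invoke p prop)
        { g.setLoc p l with net := g.net ∪ requests S p l }
  | nextRound (g : Global P O C) (p : P) (k : Pending P O C) (l : Local P O C)
      (alive : (g.loc p).crashed = false) (hk : (g.loc p).op = some k)
      (hw : waitOver S (g.loc p) k)
      (hc : ¬ canCommit (g.loc p) k) (ha : ¬ canAdopt (g.loc p) k)
      (hl : l = (g.loc p).startRound (newLearnLB (g.loc p) k)) :
      Step S g (Event.nextRound p)
        { g.setLoc p l with net := g.net ∪ requests S p l }
  | commit (g : Global P O C) (p : P) (k : Pending P O C)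
      (alive : (g.loc p).crashed = false) (hk : (g.loc p).op = some k)
      (hw : waitOver S (g.loc p) k) (hc : canCommit (g.loc p) k) :
      Step S g (Event.commit p (g.loc p).vars.candidate)
        { g.setLoc p { g.loc p with op := none } with
          bcasts := insert ⟨p, (g.loc p).vars.candidate⟩ g.bcasts }
  | commitCrash (g : Global P O C) (p : P) (k : Pending P O C)
      (alive : (g.loc p).crashed = false) (hk : (g.loc p).op = some k)
      (hw : waitOver S (g.loc p) k) (hc : canCommit (g.loc p) k) :
      Step S g (Event.commitCrash p (g.loc p).vars.candidate)
        { g.setLoc p { g.loc p with crashed := true } with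
          bcasts := insert ⟨p, (g.loc p).vars.candidate⟩ g.bcasts }
  | adopt (g : Global P O C) (p : P) (k : Pending P O C)
      (alive : (g.loc p).crashed = false) (hk : (g.loc p).op = some k)
      (hw : waitOver S (g.loc p) k)
      (hc : ¬ canCommit (g.loc p) k) (ha : canAdopt (g.loc p) k) :
      Step S g (Event.adopt p (g.loc p).vars.v)
        (g.setLoc p { g.loc p with op := none })
  | receive (g : Global P O C) (m : Packet P O C) (l : Local P O C)
      (alive : (g.loc m.dst).crashed = false) (hm : m ∈ g.net)
      (hl : l = (g.loc m.dst).receive m.src m.kind m.content) :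
      Step S g (Event.receive m)
        { g.setLoc m.dst l with net := g.net ∪ responses m l }
  | deliver (g : Global P O C) (q : P) (m : CommitMsg P O C)
      (alive : (g.loc q).crashed = false) (hm : m ∈ g.bcasts) :
      Step S g (Event.deliver q m)
        (g.setLoc q { g.loc q with vars := updateState (g.loc q).vars m.content })
  | crash (g : Global P O C) (p : P) (alive : (g.loc p).crashed = false) :
      Step S g (Event.crash p) (g.setLoc p { g.loc p with crashed := true })

/-- An execution of the algorithm: `state t` is the global state before the event `event t`.
Finite executions are those that end with `silent` events only. -/
structure Run {P O C : Type*} [SemilatticeSup O] [SemilatticeSup C] (S : System P O C) where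
  state : ℕ → Global P O C
  event : ℕ → Event P O C
  init : state 0 = Global.initial S
  step : ∀ t, Step S (state t) (event t) (state (t + 1))

namespace Run

variable {P O C : Type*} [SemilatticeSup O] [SemilatticeSup C] {S : System P O C}

/-- At time `t`, process `p` invokes `propose x`. -/
def Proposes (ρ : Run S) (t : ℕ) (p : P) (x : O × C) : Prop :=
  ρ.event t = Event.invoke p x

/-- At time `t`, the operation of process `p` returns `y`: process `p` learns `y`. -/
def Learns (ρ : Run S) (t : ℕ) (p : P) (y : O × C) : Prop :=
  ρ.event t = Event.commit p y ∨ ρ.event t = Event.adopt p y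

/-- At time `t`, the process `p` broadcasts `m` as the last action before it returns or fails. -/
def Broadcasts (ρ : Run S) (t : ℕ) (p : P) (m : CommitMsg P O C) : Prop :=
  m.origin = p ∧
    (ρ.event t = Event.commit p m.state ∨ ρ.event t = Event.commitCrash p m.state)

/-- A complete operation of `p`, invoked at `t₁` with argument `x`, returning `y` at `t₂`. -/
def Operation (ρ : Run S) (p : P) (t₁ : ℕ) (x : O × C) (t₂ : ℕ) (y : O × C) : Prop :=
  t₁ < t₂ ∧ ρ.Proposes t₁ p x ∧ ρ.Learns t₂ p y ∧
    ∀ t, t₁ < t → t < t₂ → ∀ z, ¬ ρ.Learns t p z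

/-! ### Safety properties -/

/-- The learnt states are totally ordered. -/
def Consistency (ρ : Run S) : Prop :=
  ∀ t p y t' p' y', ρ.Learns t p y → ρ.Learns t' p' y' → y ≤ y' ∨ y' ≤ y

/-- A value `y` returned by `propose x` is the join of the initial state and finitely many
values proposed before the return, among them `x` (just the join of these proposed values, if
`x` is above the initial state), and is above every value learnt before the invocation. -/
def Validity (ρ : Run S) : Prop :=
  ∀ p t₁ x t₂ y, ρ.Operation p t₁ x t₂ y →
    (∃ A : Finset (O × C), x ∈ A ∧ (∀ z ∈ A, ∃ t < t₂, ∃ q, ρ.Proposes t q z) ∧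
      IsLUB (insert S.start (A : Set (O × C))) y ∧
      (S.start ≤ x → IsLUB (A : Set (O × C)) y)) ∧
    ∀ t < t₁, ∀ q z, ρ.Learns t q z → z ≤ y

/-! ### Failures and correct participants -/

/-- Process `p` has failed by time `t`. -/
def Failed (ρ : Run S) (t : ℕ) (p : P) : Prop :=
  ((ρ.state t).loc p).crashed = true

/-- The configuration `c` is potential at time `t`: a join of `C₀` and finitely many
configurations proposed before. -/
def Potential (ρ : Run S) (t : ℕ) (c : C) : Prop :=
  ∃ A : Finset C, (∀ a ∈ A, ∃ t' < t, ∃ p x, ρ.Proposes t' p x ∧ x.2 = a) ∧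
    c = joinWith S.C₀ A

/-- The configuration `c` is superseded at time `t`: a state with a strictly greater
configuration has been learnt before. -/
def Superseded (ρ : Run S) (t : ℕ) (c : C) : Prop :=
  ∃ t' < t, ∃ p y, ρ.Learns t' p y ∧ c < y.2

/-- A replica is active at time `t` if it is a member of an active configuration. -/
def ActiveReplica (ρ : Run S) (t : ℕ) (r : P) : Prop :=
  ∃ c, ρ.Potential t c ∧ ¬ ρ.Superseded t c ∧ r ∈ S.members c

/-- A replica is correct if, from some point on, it is forever active and not failed. -/
def CorrectReplica (ρ : Run S) (r : P) : Prop :=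
  ∃ t₀, ∀ t ≥ t₀, ρ.ActiveReplica t r ∧ ¬ ρ.Failed t r

/-- A process is a client if it invokes some operation. -/
def Client (ρ : Run S) (p : P) : Prop :=
  ∃ t x, ρ.Proposes t p x

/-- A client is correct if it does not fail while it executes an operation. -/
def CorrectClient (ρ : Run S) (p : P) : Prop :=
  ρ.Client p ∧ ∀ t, ρ.Failed t p → ((ρ.state t).loc p).op = none

/-- The correct participants, about which the communication primitives give guarantees:
correct replicas, and clients that never fail. -/
def Correct (ρ : Run S) (p : P) : Prop :=
  ρ.CorrectReplica p ∨ (ρ.Client p ∧ ∀ t, ¬ ρ.Failed t p)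

/-! ### Assumptions for liveness -/

/-- A process that never fails and whose wait is over eventually takes its next step. -/
def FairScheduling (ρ : Run S) : Prop :=
  ∀ p, (∀ t, ¬ ρ.Failed t p) → ∀ t k, ((ρ.state t).loc p).op = some k →
    waitOver S ((ρ.state t).loc p) k →
    ∃ t' ≥ t, ρ.event t' = Event.nextRound p ∨ ∃ y, ρ.Learns t' p y

/-- Every message sent by a correct participant to a correct participant is received. -/
def ReliableChannels (ρ : Run S) : Prop :=
  ∀ t, ∀ m ∈ (ρ.state t).net, ρ.Correct m.src → ρ.Correct m.dst →
    ∃ t', ρ.event t' = Event.receive m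

/-- Reliable broadcast: a correct process delivers the messages that it broadcasts, and every
message delivered by a correct process is delivered by every correct process. (That delivered
messages were broadcast before is part of `Step`.) -/
def ReliableBroadcast (ρ : Run S) : Prop :=
  (∀ t p m, ρ.Correct p → ρ.Broadcasts t p m → ∃ t', ρ.event t' = Event.deliver p m) ∧
  (∀ t p m, ρ.Correct p → ρ.event t = Event.deliver p m →
    ∀ q, ρ.Correct q → ∃ t', ρ.event t' = Event.deliver q m)

/-- Every correct participant is eventually informed of every learnt configuration, that is, its
estimate of the greatest committed configuration eventually reaches or exceeds it. -/
def InformedOfLearnt (ρ : Run S) : Prop :=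
  ∀ t p y, ρ.Learns t p y → ∀ q, ρ.Correct q →
    ∃ t', y.2 ≤ ((ρ.state t').loc q).vars.v.2

/-- Configuration availability: any potential configuration that is never superseded has a
quorum of correct replicas. -/
def ConfigurationAvailability (ρ : Run S) : Prop :=
  ∀ c, (∃ t, ρ.Potential t c) → (∀ t, ¬ ρ.Superseded t c) →
    ∃ Q ∈ S.quorums c, ∀ r ∈ Q, ρ.CorrectReplica r

/-- Only finitely many distinct configurations are proposed. -/
def FinitelyManyConfigurations (ρ : Run S) : Prop :=
  {c | ∃ t p x, ρ.Proposes t p x ∧ x.2 = c}.Finite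

/-- Only finitely many processes act as clients. -/
def FinitelyManyClients (ρ : Run S) : Prop :=
  {p | ρ.Client p}.Finite

/-- Every operation invoked by a correct client returns. -/
def AllReturn (ρ : Run S) : Prop :=
  ∀ p, ρ.CorrectClient p → ∀ t x, ρ.Proposes t p x → ∃ t' y, ρ.Operation p t x t' y

end Run

end RLA

set_option linter.unusedSectionVars false

theorem Monotone.eventually_eq_of_finite_range {α : Type*} [PartialOrder α] {f : ℕ → α}
    (hf : Monotone f) (h : (Set.range f).Finite) : ∃ N, ∀ n ≥ N, f n = f N := by
  obtain ⟨m, hm⟩ := h.exists_maximal (Set.range_nonempty f)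
  obtain ⟨N, rfl⟩ := hm.1
  exact ⟨N, fun n hn => le_antisymm (hm.2 ⟨n, rfl⟩ (hf hn)) (hf hn)⟩

namespace RLA

section Algebra

variable {O C : Type*} [SemilatticeSup O] [SemilatticeSup C]

theorem joinWith_le_iff {c d : C} {A : Finset C} :
    joinWith c A ≤ d ↔ c ≤ d ∧ ∀ u ∈ A, u ≤ d := by
  classical
  simp [joinWith, Finset.sup'_le_iff]

theorem le_joinWith (c : C) (A : Finset C) : c ≤ joinWith c A :=
  (joinWith_le_iff.1 le_rfl).1

theorem le_joinWith_of_mem (c : C) {A : Finset C} {u : C} (hu : u ∈ A) : u ≤ joinWith c A :=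
  (joinWith_le_iff.1 le_rfl).2 u hu

theorem joinWith_empty (c : C) : joinWith c ∅ = c :=
  le_antisymm (joinWith_le_iff.2 ⟨le_rfl, by simp⟩) (le_joinWith c ∅)

theorem isLUB_joinWith (c : C) (A : Finset C) :
    IsLUB (insert c (A : Set C)) (joinWith c A) := by
  refine ⟨?_, fun d hd => joinWith_le_iff.2 ⟨hd (Set.mem_insert _ _), fun u hu =>
    hd (Set.mem_insert_of_mem _ hu)⟩⟩
  rintro u (rfl | hu)
  · exact le_joinWith _ _
  · exact le_joinWith_of_mem _ hu

open Classical in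
theorem joinWith_joinWith (c : C) (A B : Finset C) :
    joinWith (joinWith c A) B = joinWith c (A ∪ B) := by
  apply le_antisymm
  · refine joinWith_le_iff.2 ⟨joinWith_le_iff.2 ⟨le_joinWith _ _, fun u hu => ?_⟩, fun u hu => ?_⟩
    · exact le_joinWith_of_mem _ (Finset.mem_union_left _ hu)
    · exact le_joinWith_of_mem _ (Finset.mem_union_right _ hu)
  · refine joinWith_le_iff.2 ⟨(le_joinWith _ _).trans (le_joinWith _ _), fun u hu => ?_⟩
    rcases Finset.mem_union.1 hu with hu | hu
    · exact (le_joinWith_of_mem _ hu).trans (le_joinWith _ _)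
    · exact le_joinWith_of_mem _ hu

/-- The object and the configurations known in `a` are known in `b`. -/
structure Tracked.Below (a b : Tracked O C) : Prop where
  conf : a.v.2 ≤ b.v.2
  obj : a.obj ≤ b.obj
  mem : ∀ u ∈ a.T, u ∈ b.T ∨ u ≤ b.v.2

/-- All the information of `a` is contained in `b`. -/
structure Tracked.Le (a b : Tracked O C) : Prop where
  v : a.v ≤ b.v
  below : a.Below b

namespace Tracked

theorem Below.refl (a : Tracked O C) : a.Below a := ⟨le_rfl, le_rfl, fun _ h => Or.inl h⟩

theorem Below.trans {a b c : Tracked O C} (h : a.Below b) (h' : b.Below c) : a.Below c :=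
  ⟨h.conf.trans h'.conf, h.obj.trans h'.obj, fun u hu =>
    (h.mem u hu).elim (h'.mem u) fun hu => Or.inr (hu.trans h'.conf)⟩

theorem Le.refl (a : Tracked O C) : a.Le a := ⟨le_rfl, Below.refl a⟩

theorem Le.trans {a b c : Tracked O C} (h : a.Le b) (h' : b.Le c) : a.Le c :=
  ⟨h.v.trans h'.v, h.below.trans h'.below⟩

theorem Below.candidate_le {a b : Tracked O C} (h : a.Below b) : a.candidate ≤ b.candidate :=
  ⟨h.obj, joinWith_le_iff.2 ⟨h.conf.trans (le_joinWith _ _), fun u hu =>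
    (h.mem u hu).elim (le_joinWith_of_mem _) fun hu => hu.trans (le_joinWith _ _)⟩⟩

theorem conf_mem_queried (a : Tracked O C) : a.v.2 ∈ a.queried :=
  ⟨∅, by simp, (joinWith_empty _).symm⟩

theorem candidate_mem_queried (a : Tracked O C) : a.candidate.2 ∈ a.queried :=
  ⟨a.T, Finset.Subset.refl _, rfl⟩

theorem conf_le_of_mem_queried {a : Tracked O C} {u : C} (h : u ∈ a.queried) : a.v.2 ≤ u := by
  obtain ⟨A, -, rfl⟩ := h
  exact le_joinWith _ _

theorem queried_finite (a : Tracked O C) : a.queried.Finite := by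
  refine ((a.T.powerset.finite_toSet).image (joinWith a.v.2)).subset ?_
  rintro u ⟨A, hA, rfl⟩
  exact ⟨A, by simpa using hA, rfl⟩

theorem queried_congr {a b : Tracked O C} (hv : a.v.2 = b.v.2) (hT : a.T = b.T) :
    a.queried = b.queried := by
  simp only [queried, hv, hT]

theorem conf_le_candidate (a : Tracked O C) : a.v.2 ≤ a.candidate.2 := le_joinWith _ _

theorem v_le_candidate {a : Tracked O C} (h : a.v.1 ≤ a.obj) : a.v ≤ a.candidate :=
  ⟨h, a.conf_le_candidate⟩

theorem Below.candidate_mem_queried {a b : Tracked O C} (h : a.Below b)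
    (hc : b.v.2 ≤ a.candidate.2) : a.candidate.2 ∈ b.queried := by
  classical
  refine ⟨a.T.filter (· ∈ b.T), fun u hu => (Finset.mem_filter.1 hu).2, ?_⟩
  apply le_antisymm
  · refine joinWith_le_iff.2 ⟨h.conf.trans (le_joinWith _ _), fun u hu => ?_⟩
    rcases h.mem u hu with hu' | hu'
    · exact le_joinWith_of_mem _ (Finset.mem_filter.2 ⟨hu, hu'⟩)
    · exact hu'.trans (le_joinWith _ _)
  · exact joinWith_le_iff.2 ⟨hc, fun u hu => le_joinWith_of_mem _ (Finset.mem_filter.1 hu).1⟩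

end Tracked

theorem le_updateState_left (a b : Tracked O C) : a.Le (updateState a b) := by
  refine ⟨le_sup_left, (le_sup_left : a.v ≤ a.v ⊔ b.v).2, le_sup_left, fun u hu => ?_⟩
  by_cases h : u ≤ (a.v ⊔ b.v).2
  · exact Or.inr h
  · exact Or.inl (by simp [updateState]; exact ⟨Or.inl hu, h⟩)

theorem le_updateState_right (a b : Tracked O C) : b.Le (updateState a b) := by
  refine ⟨le_sup_right, (le_sup_right : b.v ≤ a.v ⊔ b.v).2, le_sup_right, fun u hu => ?_⟩
  by_cases h : u ≤ (a.v ⊔ b.v).2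
  · exact Or.inr h
  · exact Or.inl (by simp [updateState]; exact ⟨Or.inr hu, h⟩)

theorem not_le_of_mem_updateState {a b : Tracked O C} {u : C} (hu : u ∈ (updateState a b).T) :
    ¬ u ≤ (updateState a b).v.2 := by
  simp only [updateState, Finset.mem_filter] at hu
  exact hu.2

theorem candidate_updateState (a b : Tracked O C) :
    (updateState a b).candidate = a.candidate ⊔ b.candidate := by
  apply le_antisymm
  · refine ⟨sup_le_sup le_rfl le_rfl, joinWith_le_iff.2 ⟨?_, fun u hu => ?_⟩⟩
    · exact sup_le_sup a.conf_le_candidate b.conf_le_candidate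
    · simp only [updateState, Finset.mem_filter, Finset.mem_union] at hu
      rcases hu.1 with hu | hu
      · exact (le_joinWith_of_mem _ hu).trans (le_sup_left : a.candidate ≤ _).2
      · exact (le_joinWith_of_mem _ hu).trans (le_sup_right : b.candidate ≤ _).2
  · exact sup_le (le_updateState_left a b).below.candidate_le
      (le_updateState_right a b).below.candidate_le

theorem candidate_invoke (a : Tracked O C) (x : O × C) :
    (updateState a ⟨a.v, x.1, {x.2}⟩).candidate = a.candidate ⊔ x := by
  rw [candidate_updateState]
  apply le_antisymm
  · refine sup_le le_sup_left ⟨(le_sup_right : x ≤ a.candidate ⊔ x).1, joinWith_le_iff.2 ⟨?_, ?_⟩⟩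
    · exact a.conf_le_candidate.trans (le_sup_left : a.candidate ≤ _).2
    · intro u hu
      rw [Finset.mem_singleton.1 hu]
      exact (le_sup_right : x ≤ a.candidate ⊔ x).2
  · exact sup_le_sup le_rfl ⟨le_rfl, le_joinWith_of_mem _ (Finset.mem_singleton_self x.2)⟩

theorem candidate_commit (y : O × C) : (⟨y, y.1, ∅⟩ : Tracked O C).candidate = y :=
  Prod.ext rfl (joinWith_empty _)

theorem isLUB_sup {α : Type*} [SemilatticeSup α] {s : α} {A B : Set α} {a b : α}
    (ha : IsLUB (insert s A) a) (hb : IsLUB (insert s B) b) :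
    IsLUB (insert s (A ∪ B)) (a ⊔ b) := by
  rw [Set.insert_union_distrib]
  exact ha.union hb

/-! ### Chains of certificates -/

/-- The candidates of `a` and `b` are comparable, and each candidate configuration that lies in
the range of the other state is queried there. -/
structure Tracked.Linked (a b : Tracked O C) : Prop where
  comparable : a.candidate ≤ b.candidate ∨ b.candidate ≤ a.candidate
  queried_left : a.v.2 ≤ b.candidate.2 → b.candidate.2 ≤ a.candidate.2 → b.candidate.2 ∈ a.queried
  queried_right : b.v.2 ≤ a.candidate.2 → a.candidate.2 ≤ b.candidate.2 →
    a.candidate.2 ∈ b.queried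

theorem Tracked.Linked.symm {a b : Tracked O C} (h : a.Linked b) : b.Linked a :=
  ⟨h.comparable.symm, h.queried_right, h.queried_left⟩

theorem Tracked.linked_of_below {a b : Tracked O C} (h : a.Below b) : a.Linked b where
  comparable := Or.inl h.candidate_le
  queried_left _ h2 := by
    rw [le_antisymm h2 h.candidate_le.2]
    exact a.candidate_mem_queried
  queried_right h1 _ := h.candidate_mem_queried h1

theorem Tracked.linked_of_candidate_le {a b : Tracked O C} (hb : b.v.1 ≤ b.obj)
    (h : a.candidate ≤ b.v) : a.Linked b where
  comparable := Or.inl (h.trans (v_le_candidate hb))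
  queried_left _ h2 := by
    rw [le_antisymm h2 (h.trans (v_le_candidate hb)).2]
    exact a.candidate_mem_queried
  queried_right h1 _ := by
    rw [← le_antisymm h1 h.2]
    exact b.conf_mem_queried

/-- `K t a` says that `a` is certified at time `t`; its estimate `a.v` is the initial state or
has been certified before. -/
structure CertChain (start : O × C) (K : ℕ → Tracked O C → Prop) : Prop where
  start_le : ∀ t a, K t a → start ≤ a.v
  fst_le : ∀ t a, K t a → a.v.1 ≤ a.obj
  parent : ∀ t a, K t a → a.v = start ∨ ∃ t' < t, ∃ a', K t' a' ∧ a.v = a'.candidate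
  inter : ∀ t a t' a' u, K t a → K t' a' → u ∈ a.queried → u ∈ a'.queried →
    a.Below a' ∨ a'.Below a

namespace CertChain

variable {start : O × C} {K : ℕ → Tracked O C → Prop}

theorem linked (h : CertChain start K) {t : ℕ} {a : Tracked O C} {t' : ℕ} {a' : Tracked O C}
    (ha : K t a) (ha' : K t' a') : a.Linked a' := by
  obtain ⟨n, hn⟩ : ∃ n, n = t + t' := ⟨_, rfl⟩
  induction n using Nat.strong_induction_on generalizing t t' a a' with
  | _ n ih =>
    have key : ∀ {t : ℕ} {a : Tracked O C} {t' : ℕ} {a' : Tracked O C}, K t a → K t' a' →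
        n = t + t' → a.v ≤ a'.v → a.Linked a' := by
      intro t a t' a' ha ha' hn hle
      have common : ∀ u, u ∈ a.queried → u ∈ a'.queried → a.Linked a' := fun u hu hu' =>
        (h.inter t a t' a' u ha ha' hu hu').elim Tracked.linked_of_below fun hb =>
          (Tracked.linked_of_below hb).symm
      rcases h.parent t' a' ha' with h0 | ⟨s, hs, b, hb, hab⟩
      · refine common a.v.2 a.conf_mem_queried ?_
        rw [le_antisymm hle (h0 ▸ h.start_le t a ha)]
        exact a'.conf_mem_queried
      · have hl := ih (t + s) (by omega) ha hb rfl
        rcases hl.comparable with hc | hc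
        · exact Tracked.linked_of_candidate_le (h.fst_le t' a' ha') (hab ▸ hc)
        · refine common a'.v.2 ?_ a'.conf_mem_queried
          have h1 : a.v.2 ≤ b.candidate.2 := hab ▸ hle.2
          exact hab ▸ hl.queried_left h1 hc.2
    have cmp : a.v ≤ a'.v ∨ a'.v ≤ a.v := by
      rcases h.parent t a ha with h0 | ⟨s, hs, b, hb, hab⟩
      · exact Or.inl (h0 ▸ h.start_le t' a' ha')
      · rcases h.parent t' a' ha' with h0' | ⟨s', hs', b', hb', hab'⟩
        · exact Or.inr (h0' ▸ h.start_le t a ha)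
        · rw [hab, hab']
          exact (ih (s + s') (by omega) hb hb' rfl).comparable
    rcases cmp with hc | hc
    · exact key ha ha' hn hc
    · exact (key ha' ha (by omega) hc).symm

/-- A value that is the initial state or a certified one. -/
def Estimate (start : O × C) (K : ℕ → Tracked O C → Prop) (t : ℕ) (y : O × C) : Prop :=
  y = start ∨ ∃ t' < t, ∃ a, K t' a ∧ y = a.candidate

theorem start_le_candidate (h : CertChain start K) {t : ℕ} {a : Tracked O C} (ha : K t a) :
    start ≤ a.candidate :=
  (h.start_le t a ha).trans (Tracked.v_le_candidate (h.fst_le t a ha))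

theorem start_le_estimate (h : CertChain start K) {t : ℕ} {y : O × C}
    (hy : Estimate start K t y) : start ≤ y := by
  rcases hy with rfl | ⟨t', -, a, ha, rfl⟩
  · exact le_rfl
  · exact h.start_le_candidate ha

theorem estimate_total (h : CertChain start K) {t t' : ℕ} {y y' : O × C}
    (hy : Estimate start K t y) (hy' : Estimate start K t' y') : y ≤ y' ∨ y' ≤ y := by
  rcases hy with rfl | ⟨s, -, a, ha, rfl⟩
  · exact Or.inl (h.start_le_estimate hy')
  · rcases hy' with rfl | ⟨s', -, a', ha', rfl⟩
    · exact Or.inr (h.start_le_candidate ha)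
    · exact (h.linked ha ha').comparable

/-- A state `a` that has read every state certified before time `n` in a commonly queried
configuration is above all of them. -/
theorem candidate_le_of_reads (h : CertChain start K) {n m : ℕ} {a : Tracked O C}
    (hv : Estimate start K m a.v) (hfst : a.v.1 ≤ a.obj)
    (reads : ∀ t < n, ∀ b, K t b → ∀ u, u ∈ b.queried → u ∈ a.queried → b.Below a)
    {t : ℕ} (ht : t < n) {b : Tracked O C} (hb : K t b) :
    b.candidate ≤ a.candidate ∧ (a.v.2 ≤ b.candidate.2 → b.candidate.2 ∈ a.queried) := by
  induction t using Nat.strong_induction_on generalizing b with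
  | _ t ih =>
    have common : ∀ u, u ∈ b.queried → u ∈ a.queried →
        b.candidate ≤ a.candidate ∧ (a.v.2 ≤ b.candidate.2 → b.candidate.2 ∈ a.queried) :=
      fun u hu hu' =>
        ⟨(reads t ht b hb u hu hu').candidate_le, (reads t ht b hb u hu hu').candidate_mem_queried⟩
    have hbe : Estimate start K (t + 1) b.candidate := Or.inr ⟨t, by omega, b, hb, rfl⟩
    rcases h.estimate_total hbe hv with hle | hle
    · refine ⟨hle.trans (Tracked.v_le_candidate hfst), fun hc => ?_⟩
      rw [le_antisymm hle.2 hc]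
      exact a.conf_mem_queried
    · rcases h.estimate_total (h.parent t b hb) hv with hbv | hbv
      · refine common a.v.2 ?_ a.conf_mem_queried
        rcases hv with h0 | ⟨s, -, e, he, hae⟩
        · rw [h0, ← le_antisymm (h0 ▸ hbv) (h.start_le t b hb)]
          exact b.conf_mem_queried
        · rw [hae]
          rw [hae] at hbv hle
          exact (h.linked hb he).queried_left hbv.2 hle.2
      · refine common b.v.2 b.conf_mem_queried ?_
        rcases h.parent t b hb with h0 | ⟨s, hs, e, he, hbe⟩
        · rw [h0, ← le_antisymm (h0 ▸ hbv) (h.start_le_estimate hv)]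
          exact a.conf_mem_queried
        · rw [hbe]
          exact (ih s hs (hs.trans ht) he).2 (hbe ▸ hbv.2)

end CertChain

end Algebra

namespace Run

variable {P O C : Type*} [SemilatticeSup O] [SemilatticeSup C] {S : System P O C}

/-! ### One step of a run, seen from one process -/

/-- The tracked variables of `p` at time `t`. -/
def vars (ρ : Run S) (t : ℕ) (p : P) : Tracked O C := ((ρ.state t).loc p).vars

/-- The sequence number of `p` at time `t`. -/
def seq (ρ : Run S) (t : ℕ) (p : P) : ℕ := ((ρ.state t).loc p).seq

/-- The pending operation of `p` at time `t`. -/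
def op (ρ : Run S) (t : ℕ) (p : P) : Option (Pending P O C) := ((ρ.state t).loc p).op

/-- `p` begins a new round at time `t`: its requests are in the network at time `t + 1`. -/
structure BeginsRound (ρ : Run S) (t : ℕ) (p : P) (lb : Option (O × C)) : Prop where
  seq : ρ.seq (t + 1) p = ρ.seq t p + 1
  op : ρ.op (t + 1) p = some ⟨lb, (ρ.vars (t + 1) p).v, (ρ.vars (t + 1) p).obj,
    (ρ.vars (t + 1) p).T, (ρ.vars (t + 1) p).queried, ∅⟩
  sent : requests S p ((ρ.state (t + 1)).loc p) ⊆ (ρ.state (t + 1)).net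

/-- The effect on the process `p` of the event at time `t`. -/
inductive LocalStep (ρ : Run S) (t : ℕ) (p : P) : Prop
  | stutter (vars : ρ.vars (t + 1) p = ρ.vars t p) (seq : ρ.seq (t + 1) p = ρ.seq t p)
      (op : ρ.op (t + 1) p = ρ.op t p) (silent : ∀ y, ¬ ρ.Learns t p y)
  | invoke (x : O × C) (prop : ρ.Proposes t p x) (idle : ρ.op t p = none)
      (vars : ρ.vars (t + 1) p = updateState (ρ.vars t p) ⟨(ρ.vars t p).v, x.1, {x.2}⟩)
      (begins : ρ.BeginsRound t p none)
  | nextRound (k : Pending P O C) (hk : ρ.op t p = some k) (event : ρ.event t = .nextRound p)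
      (ended : waitOver S ((ρ.state t).loc p) k)
      (vars : ρ.vars (t + 1) p = ρ.vars t p)
      (begins : ρ.BeginsRound t p (newLearnLB ((ρ.state t).loc p) k))
  | learn (k : Pending P O C) (y : O × C) (hk : ρ.op t p = some k) (learns : ρ.Learns t p y)
      (ended : waitOver S ((ρ.state t).loc p) k)
      (value : (canCommit ((ρ.state t).loc p) k ∧ y = (ρ.vars t p).candidate ∧
          ρ.event t = .commit p y) ∨
        (canAdopt ((ρ.state t).loc p) k ∧ y = (ρ.vars t p).v))
      (vars : ρ.vars (t + 1) p = ρ.vars t p) (seq : ρ.seq (t + 1) p = ρ.seq t p)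
      (op : ρ.op (t + 1) p = none)
  | receive (m : Packet P O C) (dst : m.dst = p) (hm : m ∈ (ρ.state t).net)
      (event : ρ.event t = .receive m)
      (vars : ρ.vars (t + 1) p = updateState (ρ.vars t p) m.content)
      (seq : ρ.seq (t + 1) p = ρ.seq t p)
      (op : ρ.op (t + 1) p = ((ρ.state t).loc p |>.receive m.src m.kind m.content).op)
  | deliver (m : CommitMsg P O C) (hm : m ∈ (ρ.state t).bcasts)
      (event : ρ.event t = .deliver p m)
      (vars : ρ.vars (t + 1) p = updateState (ρ.vars t p) m.content)
      (seq : ρ.seq (t + 1) p = ρ.seq t p) (op : ρ.op (t + 1) p = ρ.op t p)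

theorem localStep (ρ : Run S) (t : ℕ) (p : P) : ρ.LocalStep t p := by
  have hs := ρ.step t
  generalize hg : ρ.state t = g at hs
  generalize hg' : ρ.state (t + 1) = g' at hs
  generalize he : ρ.event t = e at hs
  cases hs with
  | silent =>
    exact .stutter (by simp [vars, hg, hg']) (by simp [seq, hg, hg']) (by simp [op, hg, hg'])
      (by simp [Learns, he])
  | invoke q x l alive idle hl =>
    by_cases hpq : p = q
    · subst hpq
      refine .invoke x he (by simp [op, hg, idle]) ?_ ⟨?_, ?_, ?_⟩
      · simp [vars, hg, hg', Global.setLoc, hl, Local.startRound]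
      · simp [seq, hg, hg', Global.setLoc, hl, Local.startRound]
      · simp [vars, op, hg', Global.setLoc, hl, Local.startRound]
      · simp [hg', Global.setLoc]
    · refine .stutter ?_ ?_ ?_ ?_ <;>
        simp [vars, seq, op, Learns, hg, hg', he, Global.setLoc, hpq]
  | nextRound q k l alive hk hw hc ha hl =>
    by_cases hpq : p = q
    · subst hpq
      refine .nextRound k (by simp [op, hg, hk]) he (by rwa [hg]) ?_ ⟨?_, ?_, ?_⟩
      · simp [vars, hg, hg', Global.setLoc, hl, Local.startRound]
      · simp [seq, hg, hg', Global.setLoc, hl, Local.startRound]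
      · simp [vars, op, hg', hg, Global.setLoc, hl, Local.startRound]
      · simp [hg', Global.setLoc]
    · refine .stutter ?_ ?_ ?_ ?_ <;>
        simp [vars, seq, op, Learns, hg, hg', he, Global.setLoc, hpq]
  | commit q k alive hk hw hc =>
    by_cases hpq : p = q
    · subst hpq
      refine .learn k _ (by simp [op, hg, hk]) (Or.inl he) (by rwa [hg])
        (Or.inl ⟨by rwa [hg], by simp [vars, hg], he⟩) ?_ ?_ ?_ <;>
        simp [vars, seq, op, hg, hg', Global.setLoc]
    · refine .stutter ?_ ?_ ?_ ?_
      all_goals simp [vars, seq, op, Learns, hg, hg', he, Global.setLoc, hpq]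
      exact fun h => absurd h.symm hpq
  | commitCrash q k alive hk hw hc =>
    by_cases hpq : p = q
    · subst hpq
      refine .stutter ?_ ?_ ?_ ?_ <;>
        simp [vars, seq, op, Learns, hg, hg', he, Global.setLoc]
    · refine .stutter ?_ ?_ ?_ ?_ <;>
        simp [vars, seq, op, Learns, hg, hg', he, Global.setLoc, hpq]
  | adopt q k alive hk hw hc ha =>
    by_cases hpq : p = q
    · subst hpq
      refine .learn k _ (by simp [op, hg, hk]) (Or.inr he) (by rwa [hg])
        (Or.inr ⟨by rwa [hg], by simp [vars, hg]⟩) ?_ ?_ ?_ <;>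
        simp [vars, seq, op, hg, hg', Global.setLoc]
    · refine .stutter ?_ ?_ ?_ ?_
      all_goals simp [vars, seq, op, Learns, hg, hg', he, Global.setLoc, hpq]
      exact fun h => absurd h.symm hpq
  | receive m l alive hm hl =>
    by_cases hpq : p = m.dst
    · subst hpq
      refine .receive m rfl (by rwa [hg]) he ?_ ?_ ?_ <;>
        simp only [vars, seq, op, hg, hg'] <;> simp [Global.setLoc, hl, Local.receive]
    · refine .stutter ?_ ?_ ?_ ?_ <;>
        simp [vars, seq, op, Learns, hg, hg', he, Global.setLoc, hpq]
  | deliver q m alive hm =>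
    by_cases hpq : p = q
    · subst hpq
      refine .deliver m (by rwa [hg]) he ?_ ?_ ?_ <;>
        simp [vars, seq, op, hg, hg', Global.setLoc]
    · refine .stutter ?_ ?_ ?_ ?_ <;>
        simp [vars, seq, op, Learns, hg, hg', he, Global.setLoc, hpq]
  | crash q alive =>
    by_cases hpq : p = q
    · subst hpq
      refine .stutter ?_ ?_ ?_ ?_ <;>
        simp [vars, seq, op, Learns, hg, hg', he, Global.setLoc]
    · refine .stutter ?_ ?_ ?_ ?_ <;>
        simp [vars, seq, op, Learns, hg, hg', he, Global.setLoc, hpq]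

/-- `p` is at the end of a round at time `t`, with unchanged configurations. -/
structure StableEnd (ρ : Run S) (t : ℕ) (p : P) (k : Pending P O C) : Prop where
  op : ρ.op t p = some k
  ended : waitOver S ((ρ.state t).loc p) k
  stable : stableConfs ((ρ.state t).loc p) k

/-- Some process with tracked variables `a` may commit at time `t`. -/
def Certified (ρ : Run S) (t : ℕ) (a : Tracked O C) : Prop :=
  ∃ p k, ρ.StableEnd t p k ∧ k.oldObj = (ρ.vars t p).obj ∧ a = ρ.vars t p

theorem net_succ (ρ : Run S) (t : ℕ) :
    (ρ.state t).net ⊆ (ρ.state (t + 1)).net ∧ ∀ m ∈ (ρ.state (t + 1)).net,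
      m ∈ (ρ.state t).net ∨
      (ρ.seq (t + 1) m.src = ρ.seq t m.src + 1 ∧
        m ∈ requests S m.src ((ρ.state (t + 1)).loc m.src)) ∨
      ∃ m', ρ.event t = .receive m' ∧ m ∈ responses m' ((ρ.state (t + 1)).loc m'.dst) := by
  have hs := ρ.step t
  generalize hg : ρ.state t = g at hs
  generalize hg' : ρ.state (t + 1) = g' at hs
  generalize he : ρ.event t = e at hs
  cases hs with
  | silent | commit | commitCrash | adopt | deliver | crash =>
    exact ⟨fun m hm => by simpa [Global.setLoc] using hm,
      fun m hm => Or.inl (by simpa [Global.setLoc] using hm)⟩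
  | invoke q x l alive idle hl =>
    refine ⟨fun m hm => Or.inl hm, fun m hm => hm.imp_right fun hm => Or.inl ?_⟩
    have hsrc : m.src = q := hm.1
    subst hsrc
    refine ⟨?_, by simpa [hg', Global.setLoc] using hm⟩
    simp [seq, hg, hg', Global.setLoc, hl, Local.startRound]
  | nextRound q k l alive hk hw hc ha hl =>
    refine ⟨fun m hm => Or.inl hm, fun m hm => hm.imp_right fun hm => Or.inl ?_⟩
    have hsrc : m.src = q := hm.1
    subst hsrc
    refine ⟨?_, by simpa [hg', Global.setLoc] using hm⟩
    simp [seq, hg, hg', Global.setLoc, hl, Local.startRound]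
  | receive m' l alive hm' hl =>
    exact ⟨fun m hm => Or.inl hm, fun m hm => hm.imp_right fun hm => Or.inr
      ⟨m', rfl, by simpa [hg', Global.setLoc] using hm⟩⟩

theorem bcasts_succ (ρ : Run S) (t : ℕ) : ∀ m ∈ (ρ.state (t + 1)).bcasts,
    m ∈ (ρ.state t).bcasts ∨ ∃ a, ρ.Certified t a ∧ a = ρ.vars t m.origin ∧
      m.state = a.candidate := by
  have hs := ρ.step t
  generalize hg : ρ.state t = g at hs
  generalize hg' : ρ.state (t + 1) = g' at hs
  generalize he : ρ.event t = e at hs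
  cases hs with
  | silent | invoke | nextRound | adopt | receive | deliver | crash =>
    exact fun m hm => Or.inl (by simpa [Global.setLoc] using hm)
  | commit q k alive hk hw hc | commitCrash q k alive hk hw hc =>
    rintro m (rfl | hm)
    · refine Or.inr ⟨ρ.vars t q, ⟨q, k, ⟨by rwa [op, hg], by rwa [hg], by rw [hg]; exact hc.1⟩, ?_,
        rfl⟩, rfl, by simp [vars, hg]⟩
      rw [vars, hg]
      exact hc.2
    · exact Or.inl hm

theorem receive_mem {ρ : Run S} {t : ℕ} {m : Packet P O C} (h : ρ.event t = .receive m) :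
    m ∈ (ρ.state t).net ∧
      responses m ((ρ.state (t + 1)).loc m.dst) ⊆ (ρ.state (t + 1)).net ∧
      (ρ.state (t + 1)).loc m.dst =
        ((ρ.state t).loc m.dst).receive m.src m.kind m.content := by
  have hs := ρ.step t
  generalize hg : ρ.state t = g at hs
  generalize hg' : ρ.state (t + 1) = g' at hs
  rw [h] at hs
  cases hs with
  | receive m l alive hm hl => exact ⟨hm, by simp [Global.setLoc], by simp [Global.setLoc, hl]⟩

theorem Proposes.step {ρ : Run S} {t : ℕ} {p : P} {x : O × C} (h : ρ.Proposes t p x) :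
    ρ.op t p = none ∧ ¬ ρ.Failed t p ∧
      ρ.vars (t + 1) p = updateState (ρ.vars t p) ⟨(ρ.vars t p).v, x.1, {x.2}⟩ ∧
      ρ.BeginsRound t p none := by
  have hs := ρ.step t
  generalize hg : ρ.state t = g at hs
  generalize hg' : ρ.state (t + 1) = g' at hs
  rw [show ρ.event t = _ from h] at hs
  cases hs with
  | invoke _ _ l alive idle hl =>
    refine ⟨by rwa [op, hg], by simp [Failed, hg, alive], ?_, ?_, ?_, ?_⟩
    · simp [vars, hg, hg', Global.setLoc, hl, Local.startRound]
    · simp [seq, hg, hg', Global.setLoc, hl, Local.startRound]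
    · simp [vars, op, hg', Global.setLoc, hl, Local.startRound]
    · simp [hg', Global.setLoc]

/-- `p` completes at time `t` a round with pending operation `k`, and does not return. -/
structure EndsRound (ρ : Run S) (t : ℕ) (p : P) (k : Pending P O C) : Prop where
  op : ρ.op t p = some k
  ended : waitOver S ((ρ.state t).loc p) k
  not_commit : ¬ canCommit ((ρ.state t).loc p) k
  not_adopt : ¬ canAdopt ((ρ.state t).loc p) k
  begins : ρ.BeginsRound t p (newLearnLB ((ρ.state t).loc p) k)

theorem endsRound_of_event {ρ : Run S} {t : ℕ} {p : P} (h : ρ.event t = .nextRound p) :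
    ∃ k, ρ.EndsRound t p k := by
  have hs := ρ.step t
  generalize hg : ρ.state t = g at hs
  generalize hg' : ρ.state (t + 1) = g' at hs
  rw [h] at hs
  cases hs with
  | nextRound _ k l alive hk hw hc ha hl =>
    refine ⟨k, by rwa [op, hg], by rwa [hg], by rwa [hg], by rwa [hg], ?_, ?_, ?_⟩
    · simp [seq, hg, hg', Global.setLoc, hl, Local.startRound]
    · simp [vars, op, hg, hg', Global.setLoc, hl, Local.startRound]
    · simp [hg', Global.setLoc]

theorem failed_mono {ρ : Run S} {p : P} {t t' : ℕ} (h : t ≤ t') (hf : ρ.Failed t p) :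
    ρ.Failed t' p := by
  induction t', h using Nat.le_induction with
  | base => exact hf
  | succ t' _ ih =>
    have hs := ρ.step t'
    unfold Failed at ih ⊢
    generalize hg : ρ.state t' = g at hs ih
    generalize hg' : ρ.state (t' + 1) = g' at hs ⊢
    generalize he : ρ.event t' = e at hs
    cases hs with
    | silent => exact ih
    | invoke q _ _ alive | nextRound q _ _ alive | commit q _ alive | commitCrash q _ alive
    | adopt q _ alive | deliver q _ alive | crash q alive =>
      have hpq : p ≠ q := by
        rintro rfl
        simp [ih] at alive
      simpa [Global.setLoc, hpq] using ih
    | receive m _ alive =>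
      have hpq : p ≠ m.dst := by
        rintro rfl
        simp [ih] at alive
      simpa [Global.setLoc, hpq] using ih

/-- Induction principle for the contents of variables and messages. -/
theorem content_induction (ρ : Run S) (Q : ℕ → Tracked O C → Prop)
    (mono : ∀ t a, Q t a → Q (t + 1) a)
    (init : Q 0 ⟨S.start, S.O₀, ∅⟩)
    (merge : ∀ t a b, Q t a → Q t b → Q t (updateState a b))
    (prop : ∀ t p a x, ρ.Proposes t p x → Q t a → Q (t + 1) (updateState a ⟨a.v, x.1, {x.2}⟩))
    (commit : ∀ t a, ρ.Certified t a → Q t a → Q (t + 1) ⟨a.candidate, a.candidate.1, ∅⟩) (t : ℕ) :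
    (∀ p, Q t (ρ.vars t p)) ∧ (∀ m ∈ (ρ.state t).net, Q t m.content) ∧
      ∀ m ∈ (ρ.state t).bcasts, Q t m.content := by
  induction t with
  | zero => simpa [vars, ρ.init, Global.initial] using fun _ : P => init
  | succ t ih =>
    obtain ⟨ih1, ih2, ih3⟩ := ih
    have h1 : ∀ p, Q (t + 1) (ρ.vars (t + 1) p) := by
      intro p
      cases ρ.localStep t p with
      | stutter vars => exact vars ▸ mono _ _ (ih1 p)
      | invoke x hx idle vars => exact vars ▸ prop t p _ x hx (ih1 p)
      | nextRound k hk event ended vars => exact vars ▸ mono _ _ (ih1 p)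
      | learn k y hk learns ended value vars => exact vars ▸ mono _ _ (ih1 p)
      | receive m dst hm event vars => exact vars ▸ mono _ _ (merge _ _ _ (ih1 p) (ih2 m hm))
      | deliver m hm event vars => exact vars ▸ mono _ _ (merge _ _ _ (ih1 p) (ih3 m hm))
    refine ⟨h1, fun m hm => ?_, fun m hm => ?_⟩
    · rcases (ρ.net_succ t).2 m hm with hm | ⟨-, hm⟩ | ⟨m', -, n, -, rfl⟩
      · exact mono _ _ (ih2 m hm)
      · rw [hm.2.2.1]
        exact h1 _
      · exact h1 _
    · rcases ρ.bcasts_succ t m hm with hm | ⟨a, ha, hav, hma⟩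
      · exact mono _ _ (ih3 m hm)
      · rw [CommitMsg.content, hma]
        exact commit t a ha (hav ▸ ih1 _)

theorem vars_induction (ρ : Run S) (Q : ℕ → Tracked O C → Prop)
    (mono : ∀ t a, Q t a → Q (t + 1) a)
    (init : Q 0 ⟨S.start, S.O₀, ∅⟩)
    (merge : ∀ t a b, Q t a → Q t b → Q t (updateState a b))
    (prop : ∀ t p a x, ρ.Proposes t p x → Q t a → Q (t + 1) (updateState a ⟨a.v, x.1, {x.2}⟩))
    (commit : ∀ t a, ρ.Certified t a → Q t a → Q (t + 1) ⟨a.candidate, a.candidate.1, ∅⟩)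
    (t : ℕ) (p : P) : Q t (ρ.vars t p) :=
  (ρ.content_induction Q mono init merge prop commit t).1 p

/-! ### Monotonicity and rounds -/

variable (ρ : Run S)

theorem vars_le_succ (t : ℕ) (p : P) : (ρ.vars t p).Le (ρ.vars (t + 1) p) := by
  cases ρ.localStep t p with
  | stutter vars => exact vars ▸ .refl _
  | invoke x hx idle vars => exact vars ▸ le_updateState_left _ _
  | nextRound k hk event ended vars => exact vars ▸ .refl _
  | learn k y hk learns ended value vars => exact vars ▸ .refl _
  | receive m dst hm event vars => exact vars ▸ le_updateState_left _ _
  | deliver m hm event vars => exact vars ▸ le_updateState_left _ _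

theorem vars_le {t t' : ℕ} (h : t ≤ t') (p : P) : (ρ.vars t p).Le (ρ.vars t' p) := by
  induction t', h using Nat.le_induction with
  | base => exact .refl _
  | succ t' _ ih => exact ih.trans (ρ.vars_le_succ t' p)

theorem seq_mono (p : P) : Monotone fun t => ρ.seq t p := by
  refine monotone_nat_of_le_succ fun t => ?_
  cases ρ.localStep t p with
  | stutter vars seq => exact seq.ge
  | invoke x hx idle vars begins => exact (Nat.le_succ _).trans begins.seq.ge
  | nextRound k hk event ended vars begins => exact (Nat.le_succ _).trans begins.seq.ge
  | learn k y hk learns ended value vars seq => exact seq.ge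
  | receive m dst hm event vars seq => exact seq.ge
  | deliver m hm event vars seq => exact seq.ge

theorem net_mono : Monotone fun t => (ρ.state t).net :=
  monotone_nat_of_le_succ fun t => (ρ.net_succ t).1

theorem fst_le_obj (t : ℕ) (p : P) : (ρ.vars t p).v.1 ≤ (ρ.vars t p).obj := by
  refine ρ.vars_induction (fun _ a => a.v.1 ≤ a.obj) (fun _ _ h => h) le_rfl ?_ ?_ ?_ t p
  · exact fun t a b ha hb => sup_le_sup ha hb
  · exact fun t p a x _ ha => sup_le (ha.trans le_sup_left) (ha.trans le_sup_left)
  · exact fun t a _ _ => le_rfl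

theorem not_le_of_mem_T (t : ℕ) (p : P) : ∀ u ∈ (ρ.vars t p).T, ¬ u ≤ (ρ.vars t p).v.2 := by
  refine ρ.vars_induction (fun _ a => ∀ u ∈ a.T, ¬ u ≤ a.v.2) (fun _ _ h => h) (by simp) ?_ ?_
    (by simp) t p
  · exact fun t a b _ _ u hu => not_le_of_mem_updateState hu
  · exact fun t p a x _ _ u hu => not_le_of_mem_updateState hu

/-- `t` is the first time at which `p` has its sequence number. -/
def Fresh (t : ℕ) (p : P) : Prop := ∀ s < t, ρ.seq s p < ρ.seq t p

variable {ρ}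

theorem lt_of_seq_lt {p : P} {s t : ℕ} (h : ρ.seq s p < ρ.seq t p) : s < t :=
  (ρ.seq_mono p).reflect_lt h

theorem Fresh.eq {p : P} {s t : ℕ} (hs : ρ.Fresh s p) (ht : ρ.Fresh t p)
    (h : ρ.seq s p = ρ.seq t p) : s = t := by
  rcases lt_trichotomy s t with h' | h' | h'
  · exact absurd h (ht s h').ne
  · exact h'
  · exact absurd h (hs t h').ne'

theorem fresh_succ {p : P} {t : ℕ} (h : ρ.seq (t + 1) p = ρ.seq t p + 1) :
    ρ.Fresh (t + 1) p := fun s hs => by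
  rw [h]
  exact Nat.lt_succ_of_le (ρ.seq_mono p (Nat.le_of_lt_succ hs))

variable (ρ)

theorem fresh_of_req {t : ℕ} {m : Packet P O C} {n : ℕ} (hm : m ∈ (ρ.state t).net)
    (hn : m.kind = .req n) :
    ∃ s ≤ t, ρ.Fresh s m.src ∧ ρ.seq s m.src = n ∧ m.content = ρ.vars s m.src := by
  induction t with
  | zero => simp [ρ.init, Global.initial] at hm
  | succ t ih =>
    rcases (ρ.net_succ t).2 m hm with hm | ⟨hs, hm⟩ | ⟨m', -, n', -, rfl⟩
    · obtain ⟨s, hs, h⟩ := ih hm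
      exact ⟨s, by omega, h⟩
    · refine ⟨t + 1, le_rfl, fresh_succ hs, ?_, hm.2.2.1⟩
      have := hm.2.1
      rw [hn] at this
      exact (Kind.req.inj this).symm
    · simp at hn

theorem req_of_resp {t : ℕ} {m : Packet P O C} {n : ℕ} (hm : m ∈ (ρ.state t).net)
    (hn : m.kind = .resp n) :
    ∃ s τ, s ≤ τ ∧ τ ≤ t ∧ ρ.Fresh s m.dst ∧ ρ.seq s m.dst = n ∧
      (ρ.vars s m.dst).Le (ρ.vars τ m.src) ∧ m.content = ρ.vars τ m.src := by
  induction t with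
  | zero => simp [ρ.init, Global.initial] at hm
  | succ t ih =>
    rcases (ρ.net_succ t).2 m hm with hm | ⟨hs, hm⟩ | ⟨m', he, n', hn', rfl⟩
    · obtain ⟨s, τ, h1, h2, h⟩ := ih hm
      exact ⟨s, τ, h1, by omega, h⟩
    · have := hm.2.1
      rw [hn] at this
      cases this
    · obtain rfl : n' = n := Kind.resp.inj hn
      obtain ⟨s, hs, hf, hseq, hc⟩ := ρ.fresh_of_req (receive_mem he).1 hn'
      refine ⟨s, t + 1, by omega, le_rfl, hf, hseq, ?_, rfl⟩
      have hl : m'.content.Le (ρ.vars (t + 1) m'.dst) := by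
        have hs := ρ.step t
        generalize hg : ρ.state t = g at hs
        generalize hg' : ρ.state (t + 1) = g' at hs
        rw [he] at hs
        cases hs with
        | receive _ l alive hm hl =>
          simpa [vars, hg', Global.setLoc, hl, Local.receive] using le_updateState_right _ _
      exact hc ▸ hl

/-- The round of the pending operation `k` of `p` at time `t` began at time `s`. -/
structure RoundStart (t : ℕ) (p : P) (k : Pending P O C) (s : ℕ) : Prop where
  le : s ≤ t
  fresh : ρ.Fresh s p
  seq : ρ.seq s p = ρ.seq t p
  oldCommit : k.oldCommit = (ρ.vars s p).v
  oldObj : k.oldObj = (ρ.vars s p).obj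
  oldT : k.oldT = (ρ.vars s p).T
  V : k.V = (ρ.vars s p).queried
  sent : ∀ u ∈ k.V, ∀ r ∈ S.members u,
    (⟨p, r, .req (ρ.seq t p), ρ.vars s p⟩ : Packet P O C) ∈ (ρ.state t).net
  responded : ∀ r ∈ k.responders, ∃ τ, s ≤ τ ∧ τ ≤ t ∧
    (ρ.vars s p).Le (ρ.vars τ r) ∧ (ρ.vars τ r).Le (ρ.vars t p)

variable {ρ}

theorem RoundStart.succ {t : ℕ} {p : P} {k : Pending P O C} {s : ℕ}
    (h : ρ.RoundStart t p k s) (hs : ρ.seq (t + 1) p = ρ.seq t p) :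
    ρ.RoundStart (t + 1) p k s where
  le := h.le.trans (Nat.le_succ t)
  fresh := h.fresh
  seq := h.seq.trans hs.symm
  oldCommit := h.oldCommit
  oldObj := h.oldObj
  oldT := h.oldT
  V := h.V
  sent u hu r hr := hs ▸ ρ.net_mono (Nat.le_succ t) (h.sent u hu r hr)
  responded r hr := by
    obtain ⟨τ, h1, h2, h3, h4⟩ := h.responded r hr
    exact ⟨τ, h1, h2.trans (Nat.le_succ t), h3, h4.trans (ρ.vars_le_succ t p)⟩

theorem BeginsRound.roundStart {t : ℕ} {p : P} {lb : Option (O × C)}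
    (h : ρ.BeginsRound t p lb) {k : Pending P O C} (hk : ρ.op (t + 1) p = some k) :
    ρ.RoundStart (t + 1) p k (t + 1) := by
  obtain rfl := Option.some.inj (h.op.symm.trans hk)
  refine ⟨le_rfl, fresh_succ h.seq, rfl, rfl, rfl, rfl, rfl, fun u hu r hr => ?_, by simp⟩
  exact h.sent ⟨rfl, rfl, rfl, u, hu, hr⟩

variable (ρ)

theorem exists_roundStart {t : ℕ} {p : P} {k : Pending P O C} (hk : ρ.op t p = some k) :
    ∃ s, ρ.RoundStart t p k s := by
  induction t generalizing k with
  | zero => simp [op, ρ.init, Global.initial] at hk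
  | succ t ih =>
    cases ρ.localStep t p with
    | stutter vars seq op =>
      obtain ⟨s, hs⟩ := ih (op ▸ hk)
      exact ⟨s, hs.succ seq⟩
    | invoke x hx idle vars begins => exact ⟨_, begins.roundStart hk⟩
    | nextRound k hk' event ended vars begins => exact ⟨_, begins.roundStart hk⟩
    | learn k y hk' learns ended value vars seq op => simp [op] at hk
    | receive m dst hm event vars seq hop =>
      rw [hop, Local.receive, Option.map_eq_some_iff] at hk
      obtain ⟨k₀, hk₀, rfl⟩ := hk
      obtain ⟨s, hs⟩ := ih hk₀
      refine ⟨s, ?_⟩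
      split
      · rename_i hkind
        have h' := hs.succ seq
        refine ⟨h'.le, h'.fresh, h'.seq, h'.oldCommit, h'.oldObj, h'.oldT, h'.V, h'.sent, ?_⟩
        rintro r (rfl | hr)
        · obtain ⟨s', τ, h1, h2, h3, h4, h5, h6⟩ := ρ.req_of_resp hm hkind
          rw [dst] at h3 h4 h5
          obtain rfl : s' = s := h3.eq hs.fresh (h4.trans hs.seq.symm)
          refine ⟨τ, h1, h2.trans (Nat.le_succ t), h5, ?_⟩
          rw [← h6, vars]
          exact le_updateState_right _ _
        · exact h'.responded r hr
      · exact hs.succ seq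
    | deliver m hm event vars seq op =>
      obtain ⟨s, hs⟩ := ih (op ▸ hk)
      exact ⟨s, hs.succ seq⟩

/-- At the end of a stable round, every queried configuration has a quorum whose members have
received the variables of the beginning of the round, and whose variables have been merged. -/
theorem StableEnd.quorums {ρ : Run S} {t : ℕ} {p : P} {k : Pending P O C}
    (h : ρ.StableEnd t p k) :
    ∃ s, ρ.RoundStart t p k s ∧ (ρ.vars s p).v.2 = (ρ.vars t p).v.2 ∧
      (ρ.vars s p).T = (ρ.vars t p).T ∧
      ∀ u ∈ (ρ.vars t p).queried, ∃ Q ∈ S.quorums u, ∀ r ∈ Q, ∃ τ, s ≤ τ ∧ τ ≤ t ∧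
        (ρ.vars s p).Le (ρ.vars τ r) ∧ (ρ.vars τ r).Le (ρ.vars t p) := by
  obtain ⟨s, hs⟩ := ρ.exists_roundStart h.op
  have h1 : (ρ.vars s p).v.2 = (ρ.vars t p).v.2 := hs.oldCommit ▸ h.stable.1
  have h2 : (ρ.vars s p).T = (ρ.vars t p).T := hs.oldT ▸ h.stable.2
  refine ⟨s, hs, h1, h2, fun u hu => ?_⟩
  rcases h.ended with h' | h'
  · exact absurd h.stable.1 h'
  · obtain ⟨Q, hQ, hr⟩ := h' u (by rwa [hs.V, Tracked.queried_congr h1 h2])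
    exact ⟨Q, hQ, fun r hrQ => hs.responded r (hr r hrQ)⟩

end Run

namespace Run

variable {P O C : Type*} [SemilatticeSup O] [SemilatticeSup C] {S : System P O C} (ρ : Run S)

/-! ### Certified states form a chain -/

theorem start_le_vars (t : ℕ) (p : P) : S.start ≤ (ρ.vars t p).v := by
  refine ρ.vars_induction (fun _ a => S.start ≤ a.v) (fun _ _ h => h) le_rfl ?_ ?_ ?_ t p
  · exact fun t a b ha hb => ha.trans le_sup_left
  · exact fun t p a x _ ha => ha.trans le_sup_left
  · rintro t a ⟨p, k, hk, -, rfl⟩ ha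
    exact ha.trans (Tracked.v_le_candidate (ρ.fst_le_obj t p))

variable {ρ}

theorem Certified.quorums {t : ℕ} {a : Tracked O C} (h : ρ.Certified t a) {u : C}
    (hu : u ∈ a.queried) :
    ∃ Q ∈ S.quorums u, ∀ r ∈ Q, ∃ τ ≤ t, a.Below (ρ.vars τ r) ∧ (ρ.vars τ r).Below a := by
  obtain ⟨p, k, hk, hobj, rfl⟩ := h
  obtain ⟨s, hs, hv, hT, hq⟩ := hk.quorums
  obtain ⟨Q, hQ, hr⟩ := hq u hu
  refine ⟨Q, hQ, fun r hrQ => ?_⟩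
  obtain ⟨τ, -, hτ, h1, h2⟩ := hr r hrQ
  refine ⟨τ, hτ, ⟨hv ▸ h1.below.conf, ?_, hT ▸ h1.below.mem⟩, h2.below⟩
  exact hobj ▸ hs.oldObj ▸ h1.below.obj

theorem Certified.below_total {t t' : ℕ} {a a' : Tracked O C} {u : C} (h : ρ.Certified t a)
    (h' : ρ.Certified t' a') (hu : u ∈ a.queried) (hu' : u ∈ a'.queried) :
    a.Below a' ∨ a'.Below a := by
  obtain ⟨Q, hQ, hr⟩ := h.quorums hu
  obtain ⟨Q', hQ', hr'⟩ := h'.quorums hu'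
  obtain ⟨r, hrQ, hrQ'⟩ := S.quorum_inter u Q hQ Q' hQ'
  obtain ⟨τ, -, h1, h2⟩ := hr r hrQ
  obtain ⟨τ', -, h1', h2'⟩ := hr' r hrQ'
  rcases le_total τ τ' with hle | hle
  · exact Or.inl ((h1.trans (ρ.vars_le hle r).below).trans h2')
  · exact Or.inr ((h1'.trans (ρ.vars_le hle r).below).trans h2)

variable (ρ)

theorem estimate_of_chain {n : ℕ}
    (h : CertChain S.start fun t a => ρ.Certified t a ∧ t < n) {t : ℕ} (ht : t ≤ n) (p : P) :
    CertChain.Estimate S.start ρ.Certified t (ρ.vars t p).v := by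
  refine ρ.vars_induction
    (fun t a => t ≤ n → CertChain.Estimate S.start ρ.Certified t a.v) ?_ ?_ ?_ ?_ ?_ t p ht
  · rintro t a ih ht
    rcases ih (by omega) with h0 | ⟨s, hs, h1⟩
    · exact Or.inl h0
    · exact Or.inr ⟨s, by omega, h1⟩
  · exact fun _ => Or.inl rfl
  · intro t a b ha hb ht
    have restrict : ∀ y, CertChain.Estimate S.start ρ.Certified t y →
        CertChain.Estimate S.start (fun t a => ρ.Certified t a ∧ t < n) t y := by
      rintro y (h0 | ⟨s, hs, e, he, h1⟩)
      · exact Or.inl h0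
      · exact Or.inr ⟨s, hs, e, ⟨he, by omega⟩, h1⟩
    rcases h.estimate_total (restrict _ (ha ht)) (restrict _ (hb ht)) with hle | hle
    · rw [show (updateState a b).v = b.v from sup_eq_right.2 hle]
      exact hb ht
    · rw [show (updateState a b).v = a.v from sup_eq_left.2 hle]
      exact ha ht
  · intro t p a x _ ha ht
    rw [show (updateState a ⟨a.v, x.1, {x.2}⟩).v = a.v from sup_idem _]
    rcases ha (by omega) with h0 | ⟨s, hs, h1⟩
    · exact Or.inl h0
    · exact Or.inr ⟨s, by omega, h1⟩
  · exact fun t a ha _ ht => Or.inr ⟨t, by omega, a, ha, rfl⟩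

theorem certChain_lt (n : ℕ) : CertChain S.start fun t a => ρ.Certified t a ∧ t < n := by
  induction n with
  | zero => exact ⟨by simp, by simp, by simp, by simp⟩
  | succ n ih =>
    refine ⟨?_, ?_, ?_, fun t a t' a' u h h' => h.1.below_total h'.1⟩
    · rintro t a ⟨⟨p, k, -, -, rfl⟩, -⟩
      exact ρ.start_le_vars t p
    · rintro t a ⟨⟨p, k, -, -, rfl⟩, -⟩
      exact ρ.fst_le_obj t p
    · rintro t a ⟨⟨p, k, -, -, rfl⟩, ht⟩
      rcases ρ.estimate_of_chain ih (Nat.le_of_lt_succ ht) p with h0 | ⟨s, hs, e, he, h1⟩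
      · exact Or.inl h0
      · exact Or.inr ⟨s, hs, e, ⟨he, by omega⟩, h1⟩

theorem estimate (t : ℕ) (p : P) : CertChain.Estimate S.start ρ.Certified t (ρ.vars t p).v :=
  ρ.estimate_of_chain (ρ.certChain_lt t) le_rfl p

theorem certChain : CertChain S.start ρ.Certified where
  start_le := by
    rintro t a ⟨p, k, -, -, rfl⟩
    exact ρ.start_le_vars t p
  fst_le := by
    rintro t a ⟨p, k, -, -, rfl⟩
    exact ρ.fst_le_obj t p
  parent := by
    rintro t a ⟨p, k, -, -, rfl⟩
    exact ρ.estimate t p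
  inter _ _ _ _ _ h h' := h.below_total h'

/-- A stable round that began after time `t₁` reads everything certified up to time `t₁`. -/
theorem StableEnd.candidate_le {ρ : Run S} {t₁ t t₂ : ℕ} {p : P} {k : Pending P O C}
    (h : ρ.StableEnd t₂ p k) (hseq : ρ.seq t₁ p < ρ.seq t₂ p) (ht : t ≤ t₁) {b : Tracked O C}
    (hb : ρ.Certified t b) :
    b.candidate ≤ (ρ.vars t₂ p).candidate ∧
      ((ρ.vars t₂ p).v.2 ≤ b.candidate.2 → b.candidate.2 ∈ (ρ.vars t₂ p).queried) := by
  refine ρ.certChain.candidate_le_of_reads (ρ.estimate t₂ p) (ρ.fst_le_obj t₂ p)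
    (n := t₁ + 1) ?_ (Nat.lt_succ_of_le ht) hb
  intro t' ht' b' hb' u hu hu'
  obtain ⟨s, hs, -, -, hq⟩ := h.quorums
  obtain ⟨Q, hQ, hr⟩ := hb'.quorums hu
  obtain ⟨Q', hQ', hr'⟩ := hq u hu'
  obtain ⟨r, hrQ, hrQ'⟩ := S.quorum_inter u Q hQ Q' hQ'
  obtain ⟨τ, hτ, h1, -⟩ := hr r hrQ
  obtain ⟨τ', hτ', -, -, h2⟩ := hr' r hrQ'
  have : t₁ < s := lt_of_seq_lt (hseq.trans_eq hs.seq.symm)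
  exact (h1.trans (ρ.vars_le (by omega) r).below).trans h2.below

/-! ### Learnt values -/

theorem Learns.cases {ρ : Run S} {t : ℕ} {p : P} {y : O × C} (h : ρ.Learns t p y) :
    ∃ k, ρ.op t p = some k ∧ waitOver S ((ρ.state t).loc p) k ∧
      ((canCommit ((ρ.state t).loc p) k ∧ y = (ρ.vars t p).candidate ∧
          ρ.event t = .commit p y) ∨
        (canAdopt ((ρ.state t).loc p) k ∧ y = (ρ.vars t p).v)) := by
  cases ρ.localStep t p with
  | stutter _ _ _ silent => exact absurd h (silent y)
  | invoke x hx => simp [Learns, show ρ.event t = _ from hx] at h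
  | nextRound k hk event => simp [Learns, event] at h
  | receive m _ _ event => simp [Learns, event] at h
  | deliver m _ event => simp [Learns, event] at h
  | learn k y' hk learns ended value =>
    have hy : y = y' := by
      rcases h with h | h <;> rcases learns with h' | h' <;> rw [h] at h' <;> cases h' <;> rfl
    subst hy
    exact ⟨k, hk, ended, value⟩

theorem Learns.estimate {ρ : Run S} {t : ℕ} {p : P} {y : O × C} (h : ρ.Learns t p y) :
    CertChain.Estimate S.start ρ.Certified (t + 1) y := by
  obtain ⟨k, hk, ended, ⟨hc, rfl, -⟩ | ⟨-, rfl⟩⟩ := h.cases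
  · exact Or.inr ⟨t, Nat.lt_succ_self t, _, ⟨p, k, ⟨hk, ended, hc.1⟩, hc.2, rfl⟩, rfl⟩
  · rcases ρ.estimate t p with h0 | ⟨s, hs, h1⟩
    · exact Or.inl h0
    · exact Or.inr ⟨s, by omega, h1⟩

theorem consistency : ρ.Consistency := fun _ _ _ _ _ _ h h' =>
  ρ.certChain.estimate_total h.estimate h'.estimate

/-- `b` is the candidate of `p` at the end of a stable round that began after time `t₁`. -/
def StableCandidate (t₁ t : ℕ) (p : P) (b : O × C) : Prop :=
  ∃ s k, t₁ < s ∧ s ≤ t ∧ ρ.StableEnd s p k ∧ ρ.seq t₁ p < ρ.seq s p ∧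
    b = (ρ.vars s p).candidate

variable {ρ}

theorem StableCandidate.mono {t₁ t t' : ℕ} {p : P} {b : O × C}
    (h : ρ.StableCandidate t₁ t p b) (ht : t ≤ t') : ρ.StableCandidate t₁ t' p b := by
  obtain ⟨s, k, h1, h2, h3⟩ := h
  exact ⟨s, k, h1, h2.trans ht, h3⟩

theorem newLearnLB_eq_some {l : Local P O C} {k : Pending P O C} {b : O × C}
    (h : newLearnLB l k = some b) :
    k.learnLB = some b ∨ (stableConfs l k ∧ b = l.vars.candidate) := by
  unfold newLearnLB at h
  split at h
  · rename_i h'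
    exact Or.inr ⟨h'.1, (Option.some.inj h).symm⟩
  · exact Or.inl h

/-- Between its invocation and its return, an operation is pending, and its `learnLB` has been
obtained in a stable round of this operation. -/
theorem pending_of_proposes {p : P} {t₁ t : ℕ} {x : O × C} (hx : ρ.Proposes t₁ p x) (ht : t₁ < t)
    (hno : ∀ s, t₁ < s → s < t → ∀ y, ¬ ρ.Learns s p y) :
    ∃ k, ρ.op t p = some k ∧ ρ.seq t₁ p < ρ.seq t p ∧
      ∀ b, k.learnLB = some b → ρ.StableCandidate t₁ t p b := by
  induction t, ht using Nat.le_induction with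
  | base =>
    obtain ⟨-, -, -, begins⟩ := hx.step
    exact ⟨_, begins.op, by rw [begins.seq]; omega, by simp⟩
  | succ t ht ih =>
    obtain ⟨k, hk, hseq, hlb⟩ := ih fun s h1 h2 => hno s h1 (by omega)
    have hlb' : ∀ b, k.learnLB = some b → ρ.StableCandidate t₁ (t + 1) p b :=
      fun b hb => (hlb b hb).mono (Nat.le_succ t)
    cases ρ.localStep t p with
    | stutter vars seq op => exact ⟨k, op ▸ hk, seq ▸ hseq, hlb'⟩
    | invoke x' hx' idle => simp [idle] at hk
    | nextRound k' hk' event ended vars begins =>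
      obtain rfl := Option.some.inj (hk.symm.trans hk')
      refine ⟨_, begins.op, by rw [begins.seq]; omega, fun b hb => ?_⟩
      rcases newLearnLB_eq_some hb with hb | ⟨hst, hb⟩
      · exact hlb' b hb
      · exact ⟨t, k, ht, Nat.le_succ t, ⟨hk, ended, hst⟩, hseq, hb⟩
    | learn k' y hk' learns => exact absurd learns (hno t ht (Nat.lt_succ_self t) y)
    | receive m dst hm event vars seq op =>
      refine ⟨_, op.trans (congrArg (Option.map _) hk), seq ▸ hseq, fun b hb => hlb' b ?_⟩
      revert hb
      split <;> exact id
    | deliver m hm event vars seq op => exact ⟨k, op ▸ hk, seq ▸ hseq, hlb'⟩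

/-- The value returned by an operation is above the candidate of a stable round of it. -/
theorem Operation.stableCandidate {p : P} {t₁ t₂ : ℕ} {x y : O × C}
    (h : ρ.Operation p t₁ x t₂ y) : ∃ b ≤ y, ρ.StableCandidate t₁ t₂ p b := by
  obtain ⟨hlt, hx, hy, hno⟩ := h
  obtain ⟨k, hk, hseq, hlb⟩ := pending_of_proposes hx hlt hno
  obtain ⟨k', hk', ended, hval⟩ := hy.cases
  obtain rfl := Option.some.inj (hk.symm.trans hk')
  rcases hval with ⟨hc, rfl, -⟩ | ⟨⟨b, hb, hle⟩, rfl⟩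
  · exact ⟨_, le_rfl, t₂, k, hlt, le_rfl, ⟨hk, ended, hc.1⟩, hseq, rfl⟩
  · refine ⟨b, hle, ?_⟩
    rcases newLearnLB_eq_some hb with hb | ⟨hst, hb⟩
    · exact hlb b hb
    · exact ⟨t₂, k, hlt, le_rfl, ⟨hk, ended, hst⟩, hseq, hb⟩

theorem StableCandidate.vars_candidate_le {t₁ t : ℕ} {p : P} {b : O × C}
    (h : ρ.StableCandidate t₁ t p b) : (ρ.vars (t₁ + 1) p).candidate ≤ b := by
  obtain ⟨s, k, h1, -, -, -, rfl⟩ := h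
  exact (ρ.vars_le h1 p).below.candidate_le

/-! ### Validity -/

variable (ρ)

open Classical in
theorem candidate_isLUB (t : ℕ) (p : P) : ∃ A : Finset (O × C),
    (∀ z ∈ A, ∃ t' < t, ∃ q, ρ.Proposes t' q z) ∧
      IsLUB (insert S.start (A : Set (O × C))) (ρ.vars t p).candidate := by
  refine ρ.vars_induction (fun t a => ∃ A : Finset (O × C),
    (∀ z ∈ A, ∃ t' < t, ∃ q, ρ.Proposes t' q z) ∧
      IsLUB (insert S.start (A : Set (O × C))) a.candidate) ?_ ?_ ?_ ?_ ?_ t p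
  · rintro t a ⟨A, hA, hlub⟩
    exact ⟨A, fun z hz => (hA z hz).imp fun s h => ⟨by omega, h.2⟩, hlub⟩
  · refine ⟨∅, by simp, ?_⟩
    rw [show Tracked.candidate ⟨S.start, S.O₀, ∅⟩ = S.start from candidate_commit S.start]
    simp
  · rintro t a b ⟨A, hA, ha⟩ ⟨B, hB, hb⟩
    refine ⟨A ∪ B, fun z hz => (Finset.mem_union.1 hz).elim (hA z) (hB z), ?_⟩
    rw [candidate_updateState, Finset.coe_union]
    exact isLUB_sup ha hb
  · rintro t q a x hx ⟨A, hA, ha⟩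
    refine ⟨insert x A, fun z hz => ?_, ?_⟩
    · rcases Finset.mem_insert.1 hz with rfl | hz
      · exact ⟨t, by omega, q, hx⟩
      · exact (hA z hz).imp fun s h => ⟨by omega, h.2⟩
    · rw [candidate_invoke, Finset.coe_insert, Set.insert_comm, sup_comm]
      exact ha.insert x
  · rintro t a - ⟨A, hA, ha⟩
    refine ⟨A, fun z hz => (hA z hz).imp fun s h => ⟨by omega, h.2⟩, ?_⟩
    rwa [candidate_commit]

theorem v_isLUB (t : ℕ) (p : P) : ∃ A : Finset (O × C),
    (∀ z ∈ A, ∃ t' < t, ∃ q, ρ.Proposes t' q z) ∧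
      IsLUB (insert S.start (A : Set (O × C))) (ρ.vars t p).v := by
  rcases ρ.estimate t p with h0 | ⟨s, hs, a, ⟨q, k, -, -, rfl⟩, h1⟩
  · exact ⟨∅, by simp, by simp [h0]⟩
  · obtain ⟨A, hA, hlub⟩ := ρ.candidate_isLUB s q
    exact ⟨A, fun z hz => (hA z hz).imp fun s' h => ⟨h.1.trans hs, h.2⟩, h1 ▸ hlub⟩

variable {ρ}

theorem Learns.isLUB {t : ℕ} {p : P} {y : O × C} (h : ρ.Learns t p y) : ∃ A : Finset (O × C),
    (∀ z ∈ A, ∃ t' < t, ∃ q, ρ.Proposes t' q z) ∧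
      IsLUB (insert S.start (A : Set (O × C))) y := by
  obtain ⟨k, -, -, ⟨-, rfl, -⟩ | ⟨-, rfl⟩⟩ := h.cases
  · exact ρ.candidate_isLUB t p
  · exact ρ.v_isLUB t p

variable (ρ)

theorem validity : ρ.Validity := by
  classical
  intro p t₁ x t₂ y hop
  obtain ⟨b, hby, hb⟩ := hop.stableCandidate
  constructor
  · have hxy : x ≤ y := by
      refine le_trans ?_ (hb.vars_candidate_le.trans hby)
      rw [hop.2.1.step.2.2.1, candidate_invoke]
      exact le_sup_right
    obtain ⟨A, hA, hlub⟩ := hop.2.2.1.isLUB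
    have h1 : IsLUB (insert S.start ((insert x A : Finset (O × C)) : Set (O × C))) y := by
      rw [Finset.coe_insert, Set.insert_comm]
      simpa [hxy] using hlub.insert x
    refine ⟨insert x A, Finset.mem_insert_self x A, fun z hz => ?_, h1, fun hx => ?_⟩
    · rcases Finset.mem_insert.1 hz with rfl | hz
      · exact ⟨t₁, hop.1, p, hop.2.1⟩
      · exact hA z hz
    · refine ⟨fun z hz => h1.1 (Set.mem_insert_of_mem _ hz), fun d hd => h1.2 ?_⟩
      rintro z (rfl | hz)
      · exact hx.trans (hd (by simp))
      · exact hd hz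
  · intro t ht q z hz
    obtain ⟨s, k, h1, -, hs, hseq, rfl⟩ := hb
    refine le_trans ?_ hby
    rcases hz.estimate with rfl | ⟨t', ht', a, ha, rfl⟩
    · exact (ρ.start_le_vars s p).trans (Tracked.v_le_candidate (ρ.fst_le_obj s p))
    · exact (hs.candidate_le hseq (by omega) ha).1

end Run

namespace Run

variable {P O C : Type*} [SemilatticeSup O] [SemilatticeSup C] {S : System P O C} (ρ : Run S)

/-! ### Potential configurations -/

open Classical in
theorem potential_conf (t : ℕ) (p : P) : ρ.Potential t (ρ.vars t p).v.2 := by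
  obtain ⟨A, hA, hlub⟩ := ρ.v_isLUB t p
  refine ⟨A.image Prod.snd, fun c hc => ?_, ?_⟩
  · obtain ⟨z, hz, rfl⟩ := Finset.mem_image.1 hc
    obtain ⟨t', ht', q, hq⟩ := hA z hz
    exact ⟨t', ht', q, z, hq, rfl⟩
  · have h := (isLUB_prod.1 hlub).2
    rw [Set.image_insert_eq] at h
    refine h.unique ?_
    simpa [System.start] using isLUB_joinWith S.C₀ (A.image Prod.snd)

theorem proposed_of_mem_T (t : ℕ) (p : P) :
    ∀ u ∈ (ρ.vars t p).T, ∃ t' < t, ∃ q z, ρ.Proposes t' q z ∧ z.2 = u := by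
  classical
  refine ρ.vars_induction (fun t a => ∀ u ∈ a.T, ∃ t' < t, ∃ q z, ρ.Proposes t' q z ∧ z.2 = u)
    ?_ (by simp) ?_ ?_ (by simp) t p
  · exact fun t a ha u hu => (ha u hu).imp fun s h => ⟨by omega, h.2⟩
  · intro t a b ha hb u hu
    simp only [updateState, Finset.mem_filter, Finset.mem_union] at hu
    exact hu.1.elim (ha u) (hb u)
  · intro t q a x hx ha u hu
    simp only [updateState, Finset.mem_filter, Finset.mem_union, Finset.mem_singleton] at hu
    rcases hu.1 with hu | rfl
    · exact (ha u hu).imp fun s h => ⟨by omega, h.2⟩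
    · exact ⟨t, by omega, q, x, hx, rfl⟩

open Classical in
theorem potential_of_mem_queried {t : ℕ} {p : P} {u : C} (hu : u ∈ (ρ.vars t p).queried) :
    ρ.Potential t u := by
  obtain ⟨A, hA, rfl⟩ := hu
  obtain ⟨B, hB, h⟩ := ρ.potential_conf t p
  refine ⟨B ∪ A, fun c hc => ?_, by rw [h, joinWith_joinWith]⟩
  rcases Finset.mem_union.1 hc with hc | hc
  · exact hB c hc
  · exact ρ.proposed_of_mem_T t p c (hA hc)

/-- From time `N` on, the configurations known to `p` do not change. -/
def Settled (N : ℕ) (p : P) : Prop :=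
  ∀ t ≥ N, (ρ.vars t p).v.2 = (ρ.vars N p).v.2 ∧ (ρ.vars t p).T = (ρ.vars N p).T

variable {ρ}

theorem Settled.mono {N M : ℕ} {p : P} (h : ρ.Settled N p) (hNM : N ≤ M) : ρ.Settled M p :=
  fun t ht => ⟨(h t (hNM.trans ht)).1.trans (h M hNM).1.symm,
    (h t (hNM.trans ht)).2.trans (h M hNM).2.symm⟩

theorem Settled.queried {N t : ℕ} {p : P} (h : ρ.Settled N p) (ht : N ≤ t) :
    (ρ.vars t p).queried = (ρ.vars N p).queried :=
  Tracked.queried_congr (h t ht).1 (h t ht).2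

theorem exists_settled (hfin : ρ.FinitelyManyConfigurations) (p : P) : ∃ N, ρ.Settled N p := by
  obtain ⟨N, hN⟩ : ∃ N, ∀ n ≥ N, (ρ.vars n p).v.2 = (ρ.vars N p).v.2 := by
    refine Monotone.eventually_eq_of_finite_range (f := fun n => (ρ.vars n p).v.2)
      (fun s t h => (ρ.vars_le h p).v.2) ?_
    refine (hfin.toFinset.powerset.finite_toSet.image (joinWith S.C₀)).subset ?_
    rintro _ ⟨t, rfl⟩
    obtain ⟨B, hB, h⟩ := ρ.potential_conf t p
    refine ⟨B, ?_, h.symm⟩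
    simp only [Finset.coe_powerset, Set.mem_preimage, Set.mem_powerset_iff]
    exact fun c hc => hfin.mem_toFinset.2 ((hB c hc).imp fun s h => h.2)
  obtain ⟨M, hM⟩ : ∃ M, ∀ n ≥ M, (ρ.vars (N + n) p).T = (ρ.vars (N + M) p).T := by
    refine Monotone.eventually_eq_of_finite_range (f := fun n => (ρ.vars (N + n) p).T) ?_ ?_
    · intro s t hst u hu
      rcases (ρ.vars_le (Nat.add_le_add_left hst N) p).below.mem u hu with h | h
      · exact h
      · rw [hN _ (Nat.le_add_right N t), ← hN _ (Nat.le_add_right N s)] at h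
        exact absurd h (ρ.not_le_of_mem_T _ p u hu)
    · refine hfin.toFinset.powerset.finite_toSet.subset ?_
      rintro _ ⟨t, rfl⟩
      simp only [Finset.coe_powerset, Set.mem_preimage, Set.mem_powerset_iff]
      exact fun c hc => hfin.mem_toFinset.2
        ((ρ.proposed_of_mem_T _ p c hc).imp fun s h => h.2)
  refine ⟨N + M, fun t ht => ⟨?_, ?_⟩⟩
  · rw [hN t (by omega), hN (N + M) (by omega)]
  · obtain ⟨d, rfl⟩ := Nat.exists_eq_add_of_le (show N ≤ t by omega)
    exact hM d (by omega)

theorem exists_obj_eq (hfin : {t | ∃ p x, ρ.Proposes t p x}.Finite) (p : P) :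
    ∃ N, ∀ t ≥ N, (ρ.vars t p).obj = (ρ.vars N p).obj := by
  have hZ : {z | ∃ t q, ρ.Proposes t q z}.Finite := by
    refine (hfin.biUnion (t := fun t => {z | ∃ q, ρ.Proposes t q z}) fun t _ =>
      Set.Subsingleton.finite ?_).subset ?_
    · rintro z ⟨q, hq⟩ z' ⟨q', hq'⟩
      have := hq.symm.trans hq'
      cases this
      rfl
    · rintro z ⟨t, q, h⟩
      exact Set.mem_biUnion (show t ∈ {t | ∃ p x, ρ.Proposes t p x} from ⟨q, z, h⟩) ⟨q, h⟩
  obtain ⟨N, hN⟩ := Monotone.eventually_eq_of_finite_range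
    (f := fun n => (ρ.vars n p).candidate) (fun s t h => (ρ.vars_le h p).below.candidate_le) (by
      refine (Set.Finite.biUnion hZ.toFinset.powerset.finite_toSet
        (t := fun A => {y | IsLUB (insert S.start (A : Set (O × C))) y}) fun A _ =>
          Set.Subsingleton.finite fun y hy y' hy' => IsLUB.unique hy hy').subset ?_
      rintro _ ⟨t, rfl⟩
      obtain ⟨A, hA, h⟩ := ρ.candidate_isLUB t p
      refine Set.mem_biUnion (x := A) ?_ h
      simp only [Finset.coe_powerset, Set.mem_preimage, Set.mem_powerset_iff]
      exact fun z hz => hZ.mem_toFinset.2 ((hA z hz).imp fun s h => h.2))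
  exact ⟨N, fun t ht => congrArg Prod.fst (hN t ht)⟩

/-! ### Infinitely many rounds and flow of information -/

variable (ρ) in
/-- `p` completes infinitely many rounds. -/
def RoundsForever (p : P) : Prop :=
  ∀ n, ∃ t k, ρ.op t p = some k ∧ waitOver S ((ρ.state t).loc p) k ∧ ρ.seq n p < ρ.seq t p

theorem Settled.stableEnd {N n t : ℕ} {p : P} {k : Pending P O C} (h : ρ.Settled N p)
    (hn : N ≤ n) (hk : ρ.op t p = some k) (ended : waitOver S ((ρ.state t).loc p) k)
    (hseq : ρ.seq n p < ρ.seq t p) : ρ.StableEnd t p k := by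
  obtain ⟨s, hs⟩ := ρ.exists_roundStart hk
  have hns : n < s := lt_of_seq_lt (hseq.trans_eq hs.seq.symm)
  have h1 := h s (by omega)
  have h2 := h t (by have := hs.le; omega)
  refine ⟨hk, ended, ?_, ?_⟩
  · exact (congrArg Prod.snd hs.oldCommit).trans (h1.1.trans h2.1.symm)
  · exact hs.oldT.trans (h1.2.trans h2.2.symm)

theorem RoundsForever.exists_stableEnd {p : P} (h : ρ.RoundsForever p) {N : ℕ}
    (hN : ρ.Settled N p) (n : ℕ) :
    ∃ t k, ρ.StableEnd t p k ∧ ρ.seq n p < ρ.seq t p ∧ N ≤ t := by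
  obtain ⟨t, k, hk, ended, hseq⟩ := h (max N n)
  refine ⟨t, k, hN.stableEnd (le_max_left N n) hk ended hseq,
    (ρ.seq_mono p (le_max_right N n)).trans_lt hseq, ?_⟩
  exact (le_max_left N n).trans (lt_of_seq_lt hseq).le

theorem exists_common_queried_of_le {N : ℕ} {p q : P} (hq : ρ.Settled N q)
    (hqr : ρ.RoundsForever q) (hle : (ρ.vars N q).v.2 ≤ (ρ.vars N p).v.2) :
    ∃ u, u ∈ (ρ.vars N p).queried ∧ u ∈ (ρ.vars N q).queried := by
  refine ⟨_, (ρ.vars N p).conf_mem_queried, ?_⟩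
  rcases ρ.estimate N p with h0 | ⟨s, hs, a, ha, h1⟩
  · have : (ρ.vars N p).v.2 ≤ (ρ.vars N q).v.2 := h0 ▸ (ρ.start_le_vars N q).2
    rw [le_antisymm this hle]
    exact Tracked.conf_mem_queried _
  · obtain ⟨t, k, hk, hseq, hNt⟩ := hqr.exists_stableEnd hq N
    rw [h1, ← hq.queried hNt]
    refine (hk.candidate_le hseq hs.le ha).2 ?_
    rw [(hq t hNt).1, ← h1]
    exact hle

theorem exists_common_queried {N : ℕ} {p q : P} (hp : ρ.Settled N p) (hq : ρ.Settled N q)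
    (hpr : ρ.RoundsForever p) (hqr : ρ.RoundsForever q) :
    ∃ u, u ∈ (ρ.vars N p).queried ∧ u ∈ (ρ.vars N q).queried := by
  rcases ρ.certChain.estimate_total (ρ.estimate N q) (ρ.estimate N p) with h | h
  · exact exists_common_queried_of_le hq hqr h.2
  · obtain ⟨u, h1, h2⟩ := exists_common_queried_of_le hp hpr h.2
    exact ⟨u, h2, h1⟩

/-- Two processes that query a common configuration in infinitely many rounds inform each
other. -/
theorem exists_vars_le {N : ℕ} {p q : P} {u : C} (hp : ρ.Settled N p) (hq : ρ.Settled N q)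
    (hpr : ρ.RoundsForever p) (hqr : ρ.RoundsForever q) (hup : u ∈ (ρ.vars N p).queried)
    (huq : u ∈ (ρ.vars N q).queried) (n : ℕ) :
    ∃ t, (ρ.vars n p).Le (ρ.vars t q) := by
  obtain ⟨t, k, hk, hseq, hNt⟩ := hpr.exists_stableEnd hp n
  obtain ⟨t', k', hk', hseq', hNt'⟩ := hqr.exists_stableEnd hq t
  obtain ⟨s, hs, -, -, hQ⟩ := hk.quorums
  obtain ⟨s', hs', -, -, hQ'⟩ := hk'.quorums
  obtain ⟨Q, hQ, hr⟩ := hQ u (by rwa [hp.queried hNt])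
  obtain ⟨Q', hQ', hr'⟩ := hQ' u (by rwa [hq.queried hNt'])
  obtain ⟨r, hrQ, hrQ'⟩ := S.quorum_inter u Q hQ Q' hQ'
  obtain ⟨τ, -, hτ, h1, -⟩ := hr r hrQ
  obtain ⟨τ', hτ', -, -, h2⟩ := hr' r hrQ'
  have hns : n < s := lt_of_seq_lt (hseq.trans_eq hs.seq.symm)
  have hts : t < s' := lt_of_seq_lt (hseq'.trans_eq hs'.seq.symm)
  exact ⟨t', (ρ.vars_le hns.le p).trans (h1.trans ((ρ.vars_le (by omega) r).trans h2))⟩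

theorem exists_operation {p : P} {t₁ t : ℕ} {x y : O × C} (hx : ρ.Proposes t₁ p x) (ht : t₁ < t)
    (hy : ρ.Learns t p y) : ∃ t₂ y', ρ.Operation p t₁ x t₂ y' := by
  classical
  have hex : ∃ s, t₁ < s ∧ ∃ y, ρ.Learns s p y := ⟨t, ht, y, hy⟩
  obtain ⟨h1, y', h2⟩ := Nat.find_spec hex
  exact ⟨_, y', h1, hx, h2, fun s hs hs' z hz => Nat.find_min hex hs' ⟨hs, z, hz⟩⟩

theorem exists_operation_of_infinite {q : P} (h : {t | ∃ x, ρ.Proposes t q x}.Infinite) (n : ℕ) :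
    ∃ t₁ > n, ∃ x t₂ y, ρ.Operation q t₁ x t₂ y := by
  obtain ⟨t₁, ⟨x, hx⟩, hn⟩ := h.exists_gt n
  obtain ⟨t, ⟨x', hx'⟩, ht⟩ := h.exists_gt t₁
  by_cases hno : ∀ s, t₁ < s → s < t → ∀ y, ¬ ρ.Learns s q y
  · obtain ⟨k, hk, -⟩ := pending_of_proposes hx ht hno
    simp [hx'.step.1] at hk
  · push Not at hno
    obtain ⟨s, hs, -, y, hy⟩ := hno
    exact ⟨t₁, hn, x, exists_operation hx hs hy⟩

theorem roundsForever_of_infinite {q : P} (h : {t | ∃ x, ρ.Proposes t q x}.Infinite) :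
    ρ.RoundsForever q := by
  intro n
  obtain ⟨t₁, hn, x, t₂, y, hlt, hx, hy, hno⟩ := exists_operation_of_infinite h n
  obtain ⟨k, hk, hseq, -⟩ := pending_of_proposes hx hlt hno
  obtain ⟨k', hk', ended, -⟩ := hy.cases
  exact ⟨t₂, k', hk', ended, (ρ.seq_mono q hn.le).trans_lt hseq⟩

/-! ### Rounds of correct processes end -/

theorem responders_subset {p : P} {t₁ t₂ : ℕ} (h : t₁ ≤ t₂) (hseq : ρ.seq t₂ p ≤ ρ.seq t₁ p)
    {k₂ : Pending P O C} (hk₂ : ρ.op t₂ p = some k₂) :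
    ∃ k₁, ρ.op t₁ p = some k₁ ∧ k₁.responders ⊆ k₂.responders := by
  induction t₂, h using Nat.le_induction generalizing k₂ with
  | base => exact ⟨k₂, hk₂, subset_rfl⟩
  | succ t ht ih =>
    have h1 : ρ.seq t₁ p ≤ ρ.seq t p := ρ.seq_mono p ht
    have h2 : ρ.seq t p ≤ ρ.seq (t + 1) p := ρ.seq_mono p (Nat.le_succ t)
    cases ρ.localStep t p with
    | stutter vars seq op => exact ih (by omega) (op ▸ hk₂)
    | invoke x hx idle vars begins =>
      have := begins.seq
      omega
    | nextRound k hk event ended vars begins =>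
      have := begins.seq
      omega
    | learn k y hk learns ended value vars seq op => simp [op] at hk₂
    | receive m dst hm event vars seq op =>
      rw [op, Local.receive, Option.map_eq_some_iff] at hk₂
      obtain ⟨k, hk, rfl⟩ := hk₂
      obtain ⟨k₁, hk₁, hsub⟩ := ih (by omega) hk
      refine ⟨k₁, hk₁, hsub.trans ?_⟩
      split
      · exact Set.subset_insert _ _
      · exact subset_rfl
    | deliver m hm event vars seq op => exact ih (by omega) (op ▸ hk₂)

/-- While the wait does not end, the round does not change. -/
theorem round_of_not_waitOver {p : P} {t : ℕ} {k : Pending P O C} (hk : ρ.op t p = some k)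
    (hw : ∀ t' ≥ t, ∀ k', ρ.op t' p = some k' → ¬ waitOver S ((ρ.state t').loc p) k') {t' : ℕ}
    (ht' : t ≤ t') : ∃ k', ρ.op t' p = some k' ∧ k'.V = k.V ∧ k'.oldCommit = k.oldCommit ∧
      ρ.seq t' p = ρ.seq t p := by
  induction t', ht' using Nat.le_induction with
  | base => exact ⟨k, hk, rfl, rfl, rfl⟩
  | succ t' ht ih =>
    obtain ⟨k', hk', hV, hc, hs⟩ := ih
    cases ρ.localStep t' p with
    | stutter vars seq op => exact ⟨k', op ▸ hk', hV, hc, seq ▸ hs⟩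
    | invoke x hx idle => simp [idle] at hk'
    | nextRound k₁ hk₁ event ended => exact absurd ended (hw t' ht k₁ hk₁)
    | learn k₁ y hk₁ learns ended => exact absurd ended (hw t' ht k₁ hk₁)
    | receive m dst hm event vars seq op =>
      refine ⟨_, op.trans (congrArg (Option.map _) hk'), ?_, ?_, seq ▸ hs⟩
      · split
        · exact hV
        · exact hV
      · split
        · exact hc
        · exact hc
    | deliver m hm event vars seq op => exact ⟨k', op ▸ hk', hV, hc, seq ▸ hs⟩

theorem exists_waitOver (hrc : ρ.ReliableChannels) (hil : ρ.InformedOfLearnt)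
    (hca : ρ.ConfigurationAvailability) {p : P} (hp : ρ.Correct p) {t : ℕ} {k : Pending P O C}
    (hk : ρ.op t p = some k) :
    ∃ t' ≥ t, ∃ k', ρ.op t' p = some k' ∧ waitOver S ((ρ.state t').loc p) k' := by
  by_contra hcon
  have hw : ∀ t' ≥ t, ∀ k', ρ.op t' p = some k' → ¬ waitOver S ((ρ.state t').loc p) k' :=
    fun t' ht' k' hk' h => hcon ⟨t', ht', k', hk', h⟩
  obtain ⟨s, hs⟩ := ρ.exists_roundStart hk
  have hconf : ∀ t' ≥ t, (ρ.vars t' p).v.2 = k.oldCommit.2 := by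
    intro t' ht'
    obtain ⟨k', hk', -, hc, -⟩ := round_of_not_waitOver hk hw ht'
    by_contra hne
    exact hw t' ht' k' hk' (Or.inl (hc ▸ Ne.symm hne))
  have havail : ∀ u ∈ k.V, ∃ Q ∈ S.quorums u, ∀ r ∈ Q, ρ.CorrectReplica r := by
    intro u hu
    rw [hs.V] at hu
    refine hca u ⟨s, ρ.potential_of_mem_queried hu⟩ ?_
    rintro t' ⟨t'', -, q, y, hy, hlt⟩
    obtain ⟨n, hn⟩ := hil t'' q y hy p hp
    refine hlt.not_ge (hn.trans (((ρ.vars_le (le_max_left n t) p).v.2).trans ?_))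
    rw [hconf _ (le_max_right n t), hs.oldCommit]
    exact Tracked.conf_le_of_mem_queried hu
  have hresp : ∀ u ∈ k.V, ∀ r ∈ S.members u, ρ.CorrectReplica r →
      ∀ᶠ t' in Filter.atTop, ∀ k', ρ.op t' p = some k' → r ∈ k'.responders := by
    intro u hu r hr hcr
    obtain ⟨t₁, h₁⟩ := hrc t _ (hs.sent u hu r hr) hp (Or.inl hcr)
    obtain ⟨t₂, h₂⟩ := hrc (t₁ + 1) _ ((receive_mem h₁).2.1 ⟨_, rfl, rfl⟩) (Or.inl hcr) hp
    refine Filter.eventually_atTop.2 ⟨max t (t₂ + 1), fun t' ht' k' hk' => ?_⟩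
    obtain ⟨-, -, -, -, hseq⟩ := round_of_not_waitOver hk hw ((le_max_left _ _).trans ht')
    have ht₂ : t₂ + 1 ≤ t' := (le_max_right _ _).trans ht'
    obtain ⟨hm, -, hloc⟩ := receive_mem h₂
    obtain ⟨s', τ, h3, h4, -, h5, -⟩ := ρ.req_of_resp hm rfl
    have h6 : ρ.seq s' p ≤ ρ.seq t₂ p := ρ.seq_mono p (h3.trans h4)
    have h7 : ρ.seq t₂ p ≤ ρ.seq (t₂ + 1) p := ρ.seq_mono p (Nat.le_succ _)
    have h8 : ρ.seq (t₂ + 1) p ≤ ρ.seq t' p := ρ.seq_mono p ht₂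
    simp only at h5
    obtain ⟨k₁, hk₁, hsub⟩ := responders_subset ht₂ (by omega) hk'
    apply hsub
    rw [op, hloc, Local.receive, Option.map_eq_some_iff] at hk₁
    obtain ⟨k₀, -, rfl⟩ := hk₁
    have hkind : ρ.seq t p = ((ρ.state t₂).loc p).seq :=
      le_antisymm (h5.symm.le.trans h6) ((h7.trans h8).trans hseq.le)
    rw [if_pos (congrArg Kind.resp hkind)]
    exact Set.mem_insert _ _
  have hall : ∀ᶠ t' in Filter.atTop, ∀ u ∈ k.V, ∃ Q ∈ S.quorums u, ∀ r ∈ Q,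
      ∀ k', ρ.op t' p = some k' → r ∈ k'.responders := by
    refine (Filter.eventually_all_finite (hs.V ▸ Tracked.queried_finite _)).2 fun u hu => ?_
    obtain ⟨Q, hQ, hr⟩ := havail u hu
    refine ((Filter.eventually_all_finset Q).2 fun r hrQ =>
      hresp u hu r (S.quorum_subset u Q hQ hrQ) (hr r hrQ)).mono fun t' h => ⟨Q, hQ, h⟩
  obtain ⟨t', hall, ht'⟩ := (hall.and (Filter.eventually_ge_atTop t)).exists
  obtain ⟨k', hk', hV, -⟩ := round_of_not_waitOver hk hw ht'
  refine hw t' ht' k' hk' (Or.inr fun u hu => ?_)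
  obtain ⟨Q, hQ, h⟩ := hall u (hV ▸ hu)
  exact ⟨Q, hQ, fun r hr => h r hr k' hk'⟩

/-! ### Termination -/

theorem newLearnLB_of_learnLB {l : Local P O C} {k : Pending P O C} {b : O × C}
    (h : k.learnLB = some b) : newLearnLB l k = some b := by
  simp [newLearnLB, h]

theorem exists_newLearnLB {l : Local P O C} {k : Pending P O C} (h : stableConfs l k) :
    ∃ b, newLearnLB l k = some b := by
  rcases hk : k.learnLB with - | b
  · exact ⟨_, if_pos ⟨h, hk⟩⟩
  · exact ⟨b, newLearnLB_of_learnLB hk⟩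

theorem learnLB_persists {p : P} {t t' : ℕ} {k : Pending P O C} {b : O × C}
    (hk : ρ.op t p = some k) (hb : k.learnLB = some b) (h : t ≤ t')
    (hno : ∀ s ≥ t, ∀ y, ¬ ρ.Learns s p y) :
    ∃ k', ρ.op t' p = some k' ∧ k'.learnLB = some b := by
  induction t', h using Nat.le_induction with
  | base => exact ⟨k, hk, hb⟩
  | succ t' ht ih =>
    obtain ⟨k', hk', hb'⟩ := ih
    cases ρ.localStep t' p with
    | stutter vars seq op => exact ⟨k', op ▸ hk', hb'⟩
    | invoke x hx idle => simp [idle] at hk'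
    | nextRound k₁ hk₁ event ended vars begins =>
      obtain rfl := Option.some.inj (hk'.symm.trans hk₁)
      exact ⟨_, begins.op, newLearnLB_of_learnLB hb'⟩
    | learn k₁ y hk₁ learns => exact absurd learns (hno t' ht y)
    | receive m dst hm event vars seq op =>
      refine ⟨_, op.trans (congrArg (Option.map _) hk'), ?_⟩
      split
      · exact hb'
      · exact hb'
    | deliver m hm event vars seq op => exact ⟨k', op ▸ hk', hb'⟩

/-- A correct client that performs infinitely many operations eventually has `b ≤ v`, for every
`b` below one of its candidates. -/
theorem exists_le_v (hrb : ρ.ReliableBroadcast) {q : P}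
    (h : {t | ∃ x, ρ.Proposes t q x}.Infinite) {n : ℕ} {b : O × C}
    (hb : b ≤ (ρ.vars n q).candidate) : ∃ t, b ≤ (ρ.vars t q).v := by
  have hq : ρ.Correct q := by
    obtain ⟨t, ⟨x, hx⟩, -⟩ := h.exists_gt 0
    refine Or.inr ⟨⟨t, x, hx⟩, fun t ht => ?_⟩
    obtain ⟨t', ⟨x', hx'⟩, ht'⟩ := h.exists_gt t
    exact hx'.step.2.1 (failed_mono ht'.le ht)
  obtain ⟨t₁, hn, x, t₂, y, hop⟩ := exists_operation_of_infinite h n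
  obtain ⟨b', hb'y, hb'⟩ := hop.stableCandidate
  have hby : b ≤ y := by
    refine hb.trans (le_trans ?_ (hb'.vars_candidate_le.trans hb'y))
    exact (ρ.vars_le (by omega) q).below.candidate_le
  obtain ⟨k, -, -, ⟨-, -, he⟩ | ⟨-, rfl⟩⟩ := hop.2.2.1.cases
  · obtain ⟨t, ht⟩ := hrb.1 t₂ q ⟨q, y⟩ hq ⟨rfl, Or.inl he⟩
    refine ⟨t + 1, hby.trans ?_⟩
    have hs := ρ.step t
    generalize hg : ρ.state t = g at hs
    generalize hg' : ρ.state (t + 1) = g' at hs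
    rw [ht] at hs
    cases hs with
    | deliver q m alive hm =>
      have h := (le_updateState_right (g.loc q).vars (CommitMsg.content ⟨q, y⟩)).v
      simp only [vars, hg', Global.setLoc, Function.update_self]
      exact h
  · exact ⟨t₂, hby⟩

theorem exists_infinite_of_infinite (hfin : ρ.FinitelyManyClients)
    (h : {t | ∃ p x, ρ.Proposes t p x}.Infinite) :
    ∃ q, {t | ∃ x, ρ.Proposes t q x}.Infinite := by
  by_contra hcon
  simp only [not_exists, Set.not_infinite] at hcon
  refine h ((hfin.biUnion fun q _ => hcon q).subset ?_)
  rintro t ⟨q, x, hx⟩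
  exact Set.mem_biUnion (show q ∈ {p | ρ.Client p} from ⟨t, x, hx⟩) ⟨x, hx⟩

variable (ρ)

theorem allReturn (hfs : ρ.FairScheduling) (hrc : ρ.ReliableChannels)
    (hrb : ρ.ReliableBroadcast) (hil : ρ.InformedOfLearnt) (hca : ρ.ConfigurationAvailability)
    (hcl : ρ.FinitelyManyClients) (hconf : ρ.FinitelyManyConfigurations) : ρ.AllReturn := by
  intro p hp t₁ x hx
  by_contra hcon
  have hno : ∀ s, t₁ < s → ∀ y, ¬ ρ.Learns s p y := fun s hs y hy =>
    hcon (exists_operation hx hs hy)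
  have hpend : ∀ t, t₁ < t → ∃ k, ρ.op t p = some k ∧ ρ.seq t₁ p < ρ.seq t p ∧
      ∀ b, k.learnLB = some b → ρ.StableCandidate t₁ t p b := fun t ht =>
    pending_of_proposes hx ht fun s hs _ => hno s hs
  have halive : ∀ t, ¬ ρ.Failed t p := by
    intro t hf
    rcases le_or_gt t t₁ with ht | ht
    · exact hx.step.2.1 (failed_mono ht hf)
    · obtain ⟨k, hk, -⟩ := hpend t ht
      exact Option.some_ne_none k (hk.symm.trans (hp.2 t hf))
  have hcor : ρ.Correct p := Or.inr ⟨⟨t₁, x, hx⟩, halive⟩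
  have hnext : ∀ n, ∃ t ≥ n, ∃ k, ρ.EndsRound t p k := by
    intro n
    obtain ⟨k, hk, -⟩ := hpend (max n (t₁ + 1)) (by omega)
    obtain ⟨t, ht, k', hk', ended⟩ := exists_waitOver hrc hil hca hcor hk
    obtain ⟨t', ht', he | ⟨y, hy⟩⟩ := hfs p halive t k' hk' ended
    · exact ⟨t', by omega, endsRound_of_event he⟩
    · exact absurd hy (hno t' (by omega) y)
  have hnext' : ∀ n, ∃ t ≥ n, ∃ k, ρ.EndsRound t p k ∧ ρ.seq n p < ρ.seq t p := by
    intro n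
    obtain ⟨t, ht, k, hk⟩ := hnext n
    obtain ⟨t', ht', k', hk'⟩ := hnext (t + 1)
    refine ⟨t', by omega, k', hk', ?_⟩
    have h1 : ρ.seq n p ≤ ρ.seq t p := ρ.seq_mono p ht
    have h2 : ρ.seq (t + 1) p ≤ ρ.seq t' p := ρ.seq_mono p ht'
    have h3 := hk.begins.seq
    omega
  have hrounds : ρ.RoundsForever p := fun n => by
    obtain ⟨t, -, k, hk, hseq⟩ := hnext' n
    exact ⟨t, k, hk.op, hk.ended, hseq⟩
  obtain ⟨N, hN⟩ := exists_settled hconf p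
  by_cases hinf : {t | ∃ p x, ρ.Proposes t p x}.Finite
  · obtain ⟨M, hM⟩ := exists_obj_eq hinf p
    obtain ⟨t, ht, k, hk, hseq⟩ := hnext' (max N M)
    have hst := hN.stableEnd (le_max_left N M) hk.op hk.ended hseq
    refine hk.not_commit ⟨hst.stable, ?_⟩
    obtain ⟨s, hs⟩ := ρ.exists_roundStart hk.op
    have hns : max N M < s := lt_of_seq_lt (hseq.trans_eq hs.seq.symm)
    exact hs.oldObj.trans ((hM s (by omega)).trans (hM t (by omega)).symm)
  · obtain ⟨q, hq⟩ := exists_infinite_of_infinite hcl hinf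
    have hqr := roundsForever_of_infinite hq
    obtain ⟨N', hN'⟩ := exists_settled hconf q
    replace hN := hN.mono (le_max_left N N')
    replace hN' := hN'.mono (le_max_right N N')
    obtain ⟨u, hup, huq⟩ := exists_common_queried hN hN' hrounds hqr
    obtain ⟨t, ht, k, hk, hseq⟩ := hnext' (max (max N N') (t₁ + 1))
    have hst := hN.stableEnd (le_max_left _ _) hk.op hk.ended hseq
    obtain ⟨b, hb⟩ := exists_newLearnLB hst.stable
    have hk₁ := hk.begins.op
    rw [hb] at hk₁
    obtain ⟨k₂, hk₂, -, hlb⟩ := hpend (t + 1) (by omega)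
    obtain rfl := Option.some.inj (hk₁.symm.trans hk₂)
    obtain ⟨s, -, -, -, -, -, hbs⟩ := hlb b rfl
    obtain ⟨n, hn⟩ := exists_vars_le hN hN' hrounds hqr hup huq s
    obtain ⟨n', hn'⟩ := exists_le_v hrb hq (hbs.trans_le hn.below.candidate_le)
    obtain ⟨n'', hn''⟩ := exists_vars_le hN' hN hqr hrounds huq hup n'
    obtain ⟨t', ht', k', hk'⟩ := hnext (max n'' (t + 1))
    obtain ⟨k₃, hk₃, hb₃⟩ := learnLB_persists (t' := t') hk₁ rfl (by omega)
      fun s hs => hno s (by omega)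
    obtain rfl := Option.some.inj (hk₃.symm.trans hk'.op)
    refine hk'.not_adopt ⟨b, newLearnLB_of_learnLB hb₃, ?_⟩
    exact hn'.trans (hn''.v.trans (ρ.vars_le (by omega) p).v)

end Run

end RLA

theorem mainTheorem1 {P O C : Type*} [SemilatticeSup O] [SemilatticeSup C]
    (S : RLA.System P O C) (ρ : RLA.Run S) :
    ρ.Consistency ∧ ρ.Validity ∧
      (ρ.FairScheduling → ρ.ReliableChannels → ρ.ReliableBroadcast → ρ.InformedOfLearnt →
        ρ.ConfigurationAvailability → ρ.FinitelyManyClients →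
        ρ.FinitelyManyConfigurations → ρ.AllReturn) :=
  ⟨ρ.consistency, ρ.validity, ρ.allReturn⟩
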